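/- Let $\mathbf H^k$ be the real space of Hermitian $k\times k$ matrices, let $\Phi,\Psi\in\mathbf H^2$ with $\det\Phi<0$, and put $q_\Theta(\mu,\nu)=(\mu,\nu)^H\,\Theta\,(\mu,\nu)$ (with $(\mu,\nu)$ a column vector) and $$\mathcal C=\{(\mu,\nu)\in\mathbf C^2 : (\mu,\nu)\ne 0,\ q_\Phi(\mu,\nu)=0,\ q_\Psi(\mu,\nu)\le 0\}.$$ Assume that the subset of the closed complex plane represented by $\mathcal C$ (in homogeneous coordinates, $(\mu,\nu)\leftrightarrow\mu/\nu$) is one-dimensional, i.e. neither empty nor a singleton. **(A) Conjugate and duality.** Let $F,G\in\mathbf C^{p\times n}$ with $\operatorname{rank}(\mu G-\nu F)=p$ for all $(\mu,\nu)\neq 0$, let $E$ be a complex matrix with $n$ columns, $\mathcal A=\{a\in\mathbf C^n : (\mu G-\nu F)a=0 \text{ for some } (\mu,\nu)\in\mathcal C\}$, and let $g:\mathbf H^n\to[0,\infty]$ be the gauge $g(X)=\inf\{t\ge 0: X\in t\,\mathrm{conv}\,C\}$ of the convex hull of $C=\{aa^H : a\in\mathcal A,\ \|Ea\|\le 1\}$.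 Then $g(X)=\operatorname{tr}(EXE^H)$ if $$X\succeq 0,\qquad \Phi_{11}FXF^H+\Phi_{21}FXG^H+\Phi_{12}GXF^H+\Phi_{22}GXG^H=0,\qquad \Psi_{11}FXF^H+\Psi_{21}FXG^H+\Psi_{12}GXF^H+\Psi_{22}GXG^H\preceq 0,$$ and $g(X)=+\infty$ otherwise. 1. Let $g^*(Z)=\sup_{X\in\mathbf H^n}(\operatorname{tr}(XZ)-g(X))$. For every $Z\in\mathbf H^n$ the following are equivalent: (i) $g^*(Z)=0$; (ii) there are $P,Q\in\mathbf H^p$ with $$Q\succeq 0,\qquad Z-\begin{bmatrix}F\\G\end{bmatrix}^H(\Phi\otimes P+\Psi\otimes Q)\begin{bmatrix}F\\G\end{bmatrix}\preceq E^HE;\tag{LMI}$$ (iii) $a^HZa\le\|Ea\|^2$ for all $a\in\mathcal A$. If these fail, $g^*(Z)=+\infty$. If the inequality $q_\Psi\le 0$ is redundant in the definition of $\mathcal C$, then (ii) is equivalent to the same condition with $\Psi$ replaced by $0$. 2. Let $f:\mathbf H^n\to\mathbf R$ be any function and $f^*(Z)=\sup_X(\operatorname{tr}(XZ)-f(X))$.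 The problem of minimizing $f(X)+\sum_{k=1}^r\|Ea_k\|^2$ over $X=\sum_{k=1}^r a_ka_k^H$, $a_k\in\mathcal A$, $r\ge 0$, has the same optimal value as the problem of minimizing $f(X)+g(X)$ over $X\in\mathbf H^n$. The dual problem, to maximize $-f^*(Z)-g^*(-Z)$ over $Z\in\mathbf H^n$, has the same optimal value as maximizing $-f^*(Z)$ over all $Z,P,Q$ such that $P,Q$ satisfy (LMI) with $-Z$ in place of $Z$, and as maximizing $-f^*(Z)$ over all $Z$ with $\|Ea\|^2+a^HZa\ge 0$ for all $a\in\mathcal A$. The dual optimal value is at most the primal one. If the two are equal, $X=\sum_{k=1}^r a_ka_k^H$ with $a_k\in\mathcal A$ is primal optimal, and $Z$ is optimal for the last form of the dual, then $$f(X)+f^*(Z)=\operatorname{tr}(XZ),\qquad \|Ea_k\|^2+a_k^HZa_k=0,\quad k=1,\dots,r.$$ **(B) Generalized Kalman–Yakubovich–Popov lemma.** Let $A\in\mathbf C^{s\times s}$, $B\in\mathbf C^{s\times m}$ with $(A,B)$ controllable, i.e. $\operatorname{rank}[B,AB,\dots,A^{s-1}B]=s$, and suppose that $A$ has no eigenvalue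 $\lambda$ with $(\lambda,1)\in\mathcal C$. Put $F=[A\ B]$, $G=[I\ 0]$, $n=s+m$, let $E$ be a complex matrix with $s+m$ columns, and $M=E^HE$. Then $\operatorname{rank}(\mu G-\nu F)=s$ for all $(\mu,\nu)\ne 0$, and for every $Z\in\mathbf H^{s+m}$ the following are equivalent: there are $P,Q\in\mathbf H^s$ satisfying (LMI) with $-Z$ in place of $Z$; $\|Ea\|^2+a^HZa\ge 0$ for all $a\in\mathcal A$; and $$\begin{bmatrix}(\lambda I-A)^{-1}B\\ I\end{bmatrix}^H(M+Z)\begin{bmatrix}(\lambda I-A)^{-1}B\\ I\end{bmatrix}\succeq 0\quad\text{for all }(\lambda,1)\in\mathcal C,$$ together with $M_{22}+Z_{22}\succeq 0$ if $(1,0)\in\mathcal C$. Consequently, for every $f:\mathbf H^{s+m}\to\mathbf R$, the optimal value of the dual problem in (A.2) is that of maximizing $-f^*(Z)$ subject to these last constraints. -/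

import Mathlib

open scoped Matrix Kronecker ComplexOrder

namespace SymGauge

noncomputable section

/-- The real vector space of Hermitian matrices with rows and columns indexed by `n`. -/
abbrev Herm (n : Type*) : Type _ := selfAdjoint (Matrix n n ℂ)

/-- The real number `q_Θ(μ, ν) = (μ, ν)ᴴ Θ (μ, ν)`. -/
def quadForm (Θ : Herm (Fin 2)) (μ ν : ℂ) : ℝ :=
  (star ![μ, ν] ⬝ᵥ ((Θ : Matrix (Fin 2) (Fin 2) ℂ) *ᵥ ![μ, ν])).re

/-- The set `𝒞` of pairs `(μ, ν) ≠ 0` with `q_Φ(μ, ν) = 0` and `q_Ψ(μ, ν) ≤ 0`: a subset of a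
line or circle in the closed complex plane, in homogeneous coordinates. -/
def curve (Φ Ψ : Herm (Fin 2)) : Set (ℂ × ℂ) :=
  {x | x ≠ 0 ∧ quadForm Φ x.1 x.2 = 0 ∧ quadForm Ψ x.1 x.2 ≤ 0}

/-- The subset of the closed complex plane represented by `𝒞` is neither empty nor a singleton:
two elements of `𝒞` are not proportional, that is, they represent different points. -/
def IsOneDimensional (Φ Ψ : Herm (Fin 2)) : Prop :=
  ∃ x ∈ curve Φ Ψ, ∃ y ∈ curve Φ Ψ, x.1 * y.2 ≠ x.2 * y.1

section pencil

variable {p n q : Type*} [Fintype p] [Fintype n] [Fintype q]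

/-- The set `𝒜` of vectors `a` with `(μ G - ν F) a = 0` for some `(μ, ν) ∈ 𝒞`. -/
def dict (Φ Ψ : Herm (Fin 2)) (F G : Matrix p n ℂ) : Set (n → ℂ) :=
  {a | ∃ x ∈ curve Φ Ψ, (x.1 • G - x.2 • F) *ᵥ a = 0}

/-- The pencil has full row rank at every point of the closed complex plane. -/
def FullRowRank (F G : Matrix p n ℂ) : Prop :=
  ∀ μ ν : ℂ, (μ, ν) ≠ (0, 0) → (μ • G - ν • F).rank = Fintype.card p

/-- The Hermitian rank-one matrix `a aᴴ`. -/
def dyad (a : n → ℂ) : Herm n :=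
  ⟨Matrix.vecMulVec a (star a), by
    rw [selfAdjoint.mem_iff, Matrix.star_eq_conjTranspose, Matrix.conjTranspose_vecMulVec,
      star_star]⟩

/-- The squared Euclidean norm `‖E a‖²`. -/
def normSqE (E : Matrix q n ℂ) (a : n → ℂ) : ℝ := ‖WithLp.toLp 2 (E *ᵥ a)‖ ^ 2

/-- The real number `aᴴ Z a`. -/
def herForm (Z : Herm n) (a : n → ℂ) : ℝ := (star a ⬝ᵥ ((Z : Matrix n n ℂ) *ᵥ a)).re

/-- The real number `tr (X Z)`, the inner product of two Hermitian matrices. -/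
def trInner (X Z : Herm n) : ℝ := ((X : Matrix n n ℂ) * (Z : Matrix n n ℂ)).trace.re

/-- The Minkowski gauge `x ↦ inf {t ≥ 0 | x ∈ t C}`, with value `+∞` when there is no such `t`. -/
def minkowskiGauge {V : Type*} [AddCommGroup V] [Module ℝ V] (C : Set V) (x : V) : EReal :=
  ⨅ (t : ℝ) (_ : 0 ≤ t ∧ ∃ y ∈ C, x = t • y), (t : EReal)

/-- The set of matrices `a aᴴ` with `a ∈ 𝒜` and `‖E a‖ ≤ 1`. -/
def atoms (Φ Ψ : Herm (Fin 2)) (F G : Matrix p n ℂ) (E : Matrix q n ℂ) : Set (Herm n) :=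
  {X | ∃ a ∈ dict Φ Ψ F G, ‖WithLp.toLp 2 (E *ᵥ a)‖ ≤ 1 ∧ X = dyad a}

/-- The symmetric matrix gauge `g`: the gauge of the convex hull of the atoms. -/
def symGauge (Φ Ψ : Herm (Fin 2)) (F G : Matrix p n ℂ) (E : Matrix q n ℂ) : Herm n → EReal :=
  minkowskiGauge (convexHull ℝ (atoms Φ Ψ F G E))

/-- `Θ₁₁ F X Fᴴ + Θ₂₁ F X Gᴴ + Θ₁₂ G X Fᴴ + Θ₂₂ G X Gᴴ`. -/
def pencilMap (Θ : Herm (Fin 2)) (F G : Matrix p n ℂ) (X : Herm n) : Matrix p p ℂ :=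
  let T : Matrix (Fin 2) (Fin 2) ℂ := Θ
  let Y : Matrix n n ℂ := X
  T 0 0 • (F * Y * Fᴴ) + T 1 0 • (F * Y * Gᴴ) + T 0 1 • (G * Y * Fᴴ) + T 1 1 • (G * Y * Gᴴ)

/-- The semidefinite constraints on `X`. -/
def PrimalFeasible (Φ Ψ : Herm (Fin 2)) (F G : Matrix p n ℂ) (X : Herm n) : Prop :=
  (X : Matrix n n ℂ).PosSemidef ∧ pencilMap Φ F G X = 0 ∧ (-pencilMap Ψ F G X).PosSemidef

/-- The convex conjugate `h*(Z) = sup_X (tr (X Z) - h(X))`, over all Hermitian `X`. -/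
def conjugate (h : Herm n → EReal) (Z : Herm n) : EReal :=
  ⨆ X : Herm n, ((trInner X Z : ℝ) : EReal) - h X

/-- The stacked matrix with block rows `F` and `G`. -/
def stack (F G : Matrix p n ℂ) : Matrix (Fin 2 × p) n ℂ :=
  Matrix.of fun i j => ![F i.2 j, G i.2 j] i.1

/-- The matrices `P`, `Q` satisfy `Q ⪰ 0` and
`Z - [F; G]ᴴ (Φ ⊗ P + Ψ ⊗ Q) [F; G] ⪯ Eᴴ E`. -/
def IsCertificate (Φ Ψ : Herm (Fin 2)) (F G : Matrix p n ℂ) (E : Matrix q n ℂ)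
    (Z : Herm n) (P Q : Herm p) : Prop :=
  (Q : Matrix p p ℂ).PosSemidef ∧
    (Eᴴ * E - ((Z : Matrix n n ℂ) - (stack F G)ᴴ *
      ((Φ : Matrix (Fin 2) (Fin 2) ℂ) ⊗ₖ (P : Matrix p p ℂ) +
        (Ψ : Matrix (Fin 2) (Fin 2) ℂ) ⊗ₖ (Q : Matrix p p ℂ)) * stack F G)).PosSemidef

/-- The linear matrix inequality is feasible at `Z`. -/
def LMIFeasible (Φ Ψ : Herm (Fin 2)) (F G : Matrix p n ℂ) (E : Matrix q n ℂ)
    (Z : Herm n) : Prop :=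
  ∃ P Q : Herm p, IsCertificate Φ Ψ F G E Z P Q

/-- `aᴴ Z a ≤ ‖E a‖²` for all `a ∈ 𝒜`. -/
def BoundedOnDict (Φ Ψ : Herm (Fin 2)) (F G : Matrix p n ℂ) (E : Matrix q n ℂ)
    (Z : Herm n) : Prop :=
  ∀ a ∈ dict Φ Ψ F G, herForm Z a ≤ normSqE E a

/-- The constraint `‖E a‖² + aᴴ Z a ≥ 0` for all `a ∈ 𝒜` of the dual problem. -/
def DualFeasible (Φ Ψ : Herm (Fin 2)) (F G : Matrix p n ℂ) (E : Matrix q n ℂ)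
    (Z : Herm n) : Prop :=
  ∀ a ∈ dict Φ Ψ F G, 0 ≤ normSqE E a + herForm Z a

/-- The objective `-f*(Z)` of the dual problem. -/
def dualObj (f : Herm n → ℝ) (Z : Herm n) : EReal :=
  -conjugate (fun X => (f X : EReal)) Z

/-- The optimal value of: maximize `-f*(Z) - g*(-Z)` over all Hermitian `Z`. -/
def dualValue (Φ Ψ : Herm (Fin 2)) (F G : Matrix p n ℂ) (E : Matrix q n ℂ)
    (f : Herm n → ℝ) : EReal :=
  ⨆ Z : Herm n, dualObj f Z - conjugate (symGauge Φ Ψ F G E) (-Z)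

/-- The objective `f(X) + ∑ₖ ‖E aₖ‖²` at `X = ∑ₖ aₖ aₖᴴ`. -/
def primalObj (E : Matrix q n ℂ) (f : Herm n → ℝ) {r : ℕ} (a : Fin r → n → ℂ) : ℝ :=
  f (∑ k, dyad (a k)) + ∑ k, normSqE E (a k)

/-- The optimal value of: minimize `f(X) + ∑ₖ ‖E aₖ‖²` over all `X = ∑ₖ aₖ aₖᴴ` with finitely
many `aₖ ∈ 𝒜`. -/
def primalValue (Φ Ψ : Herm (Fin 2)) (F G : Matrix p n ℂ) (E : Matrix q n ℂ)
    (f : Herm n → ℝ) : EReal :=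
  ⨅ (r : ℕ) (a : Fin r → n → ℂ) (_ : ∀ k, a k ∈ dict Φ Ψ F G), (primalObj E f a : EReal)

end pencil

section system

variable {s m : ℕ}

/-- Controllability of `(A, B)`: the matrix `[B, A B, …, A^(s-1) B]` has rank `s`. -/
def Controllable (A : Matrix (Fin s) (Fin s) ℂ) (B : Matrix (Fin s) (Fin m) ℂ) : Prop :=
  (Matrix.of fun (i : Fin s) (j : Fin s × Fin m) => (A ^ (j.1 : ℕ) * B) i j.2).rank = s

/-- `F = [A B]`. -/
def sysF (A : Matrix (Fin s) (Fin s) ℂ) (B : Matrix (Fin s) (Fin m) ℂ) :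
    Matrix (Fin s) (Fin s ⊕ Fin m) ℂ := Matrix.fromCols A B

/-- `G = [I 0]`. -/
def sysG (s m : ℕ) : Matrix (Fin s) (Fin s ⊕ Fin m) ℂ := Matrix.fromCols 1 0

/-- The Popov function with central matrix `N`:
`[(z I - A)⁻¹ B; I]ᴴ N [(z I - A)⁻¹ B; I]`. -/
def popov (A : Matrix (Fin s) (Fin s) ℂ) (B : Matrix (Fin s) (Fin m) ℂ)
    (N : Matrix (Fin s ⊕ Fin m) (Fin s ⊕ Fin m) ℂ) (z : ℂ) : Matrix (Fin m) (Fin m) ℂ :=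
  let H : Matrix (Fin s ⊕ Fin m) (Fin m) ℂ := Matrix.fromRows ((z • 1 - A)⁻¹ * B) 1
  Hᴴ * N * H

/-- The frequency-domain constraints: the Popov function with central matrix `Eᴴ E + Z` is
positive semidefinite on the finite part of `𝒞`, and the `(2,2)` block of `Eᴴ E + Z` is positive
semidefinite if `𝒞` contains the point at infinity. -/
def PopovFeasible {q : Type*} [Fintype q] (Φ Ψ : Herm (Fin 2)) (A : Matrix (Fin s) (Fin s) ℂ)
    (B : Matrix (Fin s) (Fin m) ℂ) (E : Matrix q (Fin s ⊕ Fin m) ℂ)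
    (Z : Herm (Fin s ⊕ Fin m)) : Prop :=
  (∀ z : ℂ, (z, 1) ∈ curve Φ Ψ → (popov A B (Eᴴ * E + (Z : Matrix _ _ ℂ)) z).PosSemidef) ∧
    ((1, 0) ∈ curve Φ Ψ → (Eᴴ * E + (Z : Matrix _ _ ℂ)).toBlocks₂₂.PosSemidef)

end system

end

end SymGauge

/-! Everything rests on one fact: the sums of dyads `a aᴴ` with `a ∈ 𝒜` are exactly the matrices
that satisfy the semidefinite constraints. One inclusion is a computation: on a kernel vector, `F a
= μ s` and `G a = ν s`, so the pencil map sends `a aᴴ` to `q_Θ(μ, ν) s sᴴ` (`pencilHerm_dyad`).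

For the other inclusion, a change of basis of `ℂ²` turns the zero set of `q_Φ` into the extended
real line and `q_Ψ ≤ 0` into either no condition or `t ≥ 0` (`exists_normalForm`). The constraints
then say that `F X Gᴴ` is Hermitian, and positive semidefinite in the half-line case. Write `X = Y
Yᴴ`; the relation of pairs `((G Y)ᴴ x, (F Y)ᴴ x)` is symmetric, hence has a self-adjoint extension
with an orthonormal basis of eigenvectors `wᵢ`, infinite eigenvalue allowed. The vectors `Y wᵢ` lie
in `𝒜`, and `∑ wᵢ wᵢᴴ = 1` gives the decomposition (`exists_dict_decomposition`). Since `‖E a‖²` is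
linear in `a aᴴ`, every decomposition has the same cost `tr (E X Eᴴ)`, which is the gauge.

Thus the gauge is linear on a convex cone and `+∞` elsewhere. Its conjugate is `0` or `+∞` according
to an inequality that need only be tested on dyads from `𝒜`. Conic duality turns this inequality
into the LMI (`exists_multipliers`). The Slater point it needs is a sum of dyads of kernel vectors
at infinitely many points with `q_Ψ < 0`, and it is positive definite because such kernels span:
otherwise a quotient would be a square pencil invertible at every point of the complex projective
line, while a square pencil over `ℂ` of positive size has an eigenvalue
(`FullRowRank.span_kernels`). A redundant `Ψ` is first replaced by `-1`, which does not change `𝒞`.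

For `F = [A B]`, `G = [I 0]`, full rank is the Hautus test, and the kernels on `𝒞` are the ranges of
`[(λ I - A)⁻¹ B; I]` and, at infinity, of `[0; I]`. This gives the frequency-domain form. -/

namespace SymGauge

noncomputable section

/-! ### Hermitian forms, dyads and the trace inner product. -/

section basics

set_option linter.unusedSectionVars false

variable {p n q : Type*} [Fintype p] [Fintype n] [Fintype q]

lemma Herm.isHermitian (X : Herm n) : (X : Matrix n n ℂ).IsHermitian := X.2

@[simp] lemma Herm.coe_sum {ι : Type*} (s : Finset ι) (f : ι → Herm n) :
    ((∑ i ∈ s, f i : Herm n) : Matrix n n ℂ) = ∑ i ∈ s, (f i : Matrix n n ℂ) :=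
  AddSubgroup.val_finsetSum _ _ _

@[simp] lemma coe_dyad (a : n → ℂ) :
    (dyad a : Matrix n n ℂ) = Matrix.vecMulVec a (star a) := rfl

lemma dyad_smul (c : ℝ) (a : n → ℂ) : dyad ((c : ℂ) • a) = (c ^ 2) • dyad a := by
  apply Subtype.ext
  ext i j
  simp [Matrix.vecMulVec_apply]
  ring

/-- The matrix `Eᴴ E` as a Hermitian matrix. -/
def gram (E : Matrix q n ℂ) : Herm n := ⟨Eᴴ * E, Matrix.isHermitian_conjTranspose_mul_self E⟩

@[simp] lemma coe_gram (E : Matrix q n ℂ) : (gram E : Matrix n n ℂ) = Eᴴ * E := rfl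

lemma dotProduct_mulVec_im (Z : Herm n) (a : n → ℂ) :
    (star a ⬝ᵥ ((Z : Matrix n n ℂ) *ᵥ a)).im = 0 := by
  have h : star (star a ⬝ᵥ ((Z : Matrix n n ℂ) *ᵥ a)) = star a ⬝ᵥ ((Z : Matrix n n ℂ) *ᵥ a) := by
    rw [← Matrix.star_dotProduct, Matrix.star_mulVec, Z.isHermitian.eq,
      ← Matrix.dotProduct_mulVec]
  exact Complex.conj_eq_iff_im.mp h

lemma coe_herForm (Z : Herm n) (a : n → ℂ) :
    (herForm Z a : ℂ) = star a ⬝ᵥ ((Z : Matrix n n ℂ) *ᵥ a) :=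
  Complex.ext (by simp [herForm]) (by simp [dotProduct_mulVec_im])

lemma posSemidef_iff_herForm (Z : Herm n) :
    (Z : Matrix n n ℂ).PosSemidef ↔ ∀ a, 0 ≤ herForm Z a := by
  refine ⟨fun h a => ?_, fun h => .of_dotProduct_mulVec_nonneg Z.isHermitian fun a => ?_⟩
  · have := h.dotProduct_mulVec_nonneg a
    rw [← coe_herForm] at this
    exact_mod_cast this
  · rw [← coe_herForm]
    exact_mod_cast h a

@[simp] lemma herForm_add (Z W : Herm n) (a : n → ℂ) :
    herForm (Z + W) a = herForm Z a + herForm W a := by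
  simp [herForm, Matrix.add_mulVec, dotProduct_add]

@[simp] lemma herForm_neg (Z : Herm n) (a : n → ℂ) : herForm (-Z) a = -herForm Z a := by
  simp [herForm, Matrix.neg_mulVec]

@[simp] lemma herForm_sub (Z W : Herm n) (a : n → ℂ) :
    herForm (Z - W) a = herForm Z a - herForm W a := by
  simp [sub_eq_add_neg]

@[simp] lemma herForm_smul (c : ℝ) (Z : Herm n) (a : n → ℂ) :
    herForm (c • Z) a = c * herForm Z a := by
  simp [herForm, Matrix.smul_mulVec]

@[simp] lemma herForm_zero (a : n → ℂ) : herForm (0 : Herm n) a = 0 := by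
  simp [herForm]

lemma herForm_sum {ι : Type*} (s : Finset ι) (Z : ι → Herm n) (a : n → ℂ) :
    herForm (∑ i ∈ s, Z i) a = ∑ i ∈ s, herForm (Z i) a := by
  classical
  induction s using Finset.induction_on with
  | empty => simp
  | insert i s hi ih => rw [Finset.sum_insert hi, Finset.sum_insert hi, herForm_add, ih]

lemma herForm_dyad (a b : n → ℂ) : herForm (dyad a) b = ‖star a ⬝ᵥ b‖ ^ 2 := by
  have h : star b ⬝ᵥ a = star (star a ⬝ᵥ b) := by
    rw [Matrix.star_dotProduct]
  have : (star b ⬝ᵥ (Matrix.vecMulVec a (star a) *ᵥ b)) = ((‖star a ⬝ᵥ b‖ ^ 2 : ℝ) : ℂ) := by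
    rw [Matrix.vecMulVec_mulVec, dotProduct_smul, h, op_smul_eq_mul]
    simp [Complex.conj_mul']
  rw [herForm, coe_dyad, this, Complex.ofReal_re]

lemma dyad_posSemidef (a : n → ℂ) : (dyad a : Matrix n n ℂ).PosSemidef :=
  (posSemidef_iff_herForm _).2 fun b => by rw [herForm_dyad]; positivity

lemma herForm_gram (E : Matrix q n ℂ) (a : n → ℂ) : herForm (gram E) a = normSqE E a := by
  rw [herForm, normSqE, EuclideanSpace.norm_sq_eq, coe_gram, ← Matrix.mulVec_mulVec,
    Matrix.dotProduct_mulVec, Matrix.vecMul_conjTranspose, star_star]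
  simp [dotProduct, Complex.mul_re, ← Complex.normSq_eq_norm_sq, Complex.normSq_apply]

lemma trInner_comm (X Z : Herm n) : trInner X Z = trInner Z X := by
  rw [trInner, trInner, Matrix.trace_mul_comm]

lemma trInner_dyad (a : n → ℂ) (Z : Herm n) : trInner (dyad a) Z = herForm Z a := by
  rw [trInner, herForm, coe_dyad, Matrix.vecMulVec_mul, Matrix.trace_vecMulVec,
    Matrix.dotProduct_mulVec, dotProduct_comm]

/-- The trace inner product as a bilinear form. -/
def trForm : Herm n →ₗ[ℝ] Herm n →ₗ[ℝ] ℝ :=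
  LinearMap.mk₂ ℝ trInner (by simp [trInner, add_mul]) (by simp [trInner])
    (by simp [trInner, mul_add]) (by simp [trInner])

@[simp] lemma trForm_apply (X Z : Herm n) : trForm X Z = trInner X Z := rfl

lemma trInner_add_left (X Y Z : Herm n) : trInner (X + Y) Z = trInner X Z + trInner Y Z := by
  simp [trInner, add_mul]

lemma trInner_smul_left (c : ℝ) (X Z : Herm n) : trInner (c • X) Z = c * trInner X Z := by
  simp [trInner]

lemma trInner_neg_right (X Z : Herm n) : trInner X (-Z) = -trInner X Z := by
  simp [trInner]

lemma trInner_sum_dyad {ι : Type*} (s : Finset ι) (a : ι → n → ℂ) (Z : Herm n) :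
    trInner (∑ i ∈ s, dyad (a i)) Z = ∑ i ∈ s, herForm Z (a i) := by
  simp_rw [← trInner_dyad, ← trForm_apply, map_sum, LinearMap.sum_apply]

lemma trace_conj_re (E : Matrix q n ℂ) (X : Herm n) :
    (E * (X : Matrix n n ℂ) * Eᴴ).trace.re = trInner X (gram E) := by
  rw [trInner, coe_gram, Matrix.mul_assoc, Matrix.trace_mul_comm, Matrix.mul_assoc]

instance : FiniteDimensional ℝ (Herm n) :=
  Module.Finite.of_injective (selfAdjoint.submodule ℝ (Matrix n n ℂ)).subtype Subtype.val_injective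

/-- Every real linear functional on Hermitian matrices is a trace inner product. -/
lemma exists_trInner_eq (l : Herm n →ₗ[ℝ] ℝ) : ∃ Q : Herm n, ∀ X, l X = trInner Q X := by
  -- The trace form is definite, as `tr (X X) = tr (Xᴴ X)`; equality of dimensions then gives
  -- surjectivity onto the dual.
  have hinj : Function.Injective (trForm : Herm n →ₗ[ℝ] Herm n →ₗ[ℝ] ℝ) := by
    rw [← LinearMap.ker_eq_bot, LinearMap.ker_eq_bot']
    intro X hX
    have h0 : trInner X X = 0 := by rw [← trForm_apply, hX]; rfl
    have h1 := (Matrix.posSemidef_conjTranspose_mul_self (X : Matrix n n ℂ)).trace_nonneg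
    have h2 : ((X : Matrix n n ℂ)ᴴ * (X : Matrix n n ℂ)).trace = 0 := by
      refine Complex.ext ?_ (Complex.le_def.1 h1).2.symm
      rw [X.isHermitian.eq]
      exact h0
    exact Subtype.ext (Matrix.trace_conjTranspose_mul_self_eq_zero_iff.1 h2)
  have hsurj := (LinearMap.injective_iff_surjective_of_finrank_eq_finrank
    (Subspace.dual_finrank_eq (K := ℝ) (V := Herm n)).symm).1 hinj
  obtain ⟨Q, hQ⟩ := hsurj l
  exact ⟨Q, fun X => by rw [← hQ]; rfl⟩

end basics

/-! ### The pencil map, its adjoint, and the cone of feasible matrices. -/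

section pencils

set_option linter.unusedSectionVars false

variable {p n q : Type*} [Fintype p] [Fintype n] [Fintype q]

lemma Herm.conj_apply (Θ : Herm n) (i j : n) :
    star ((Θ : Matrix n n ℂ) i j) = (Θ : Matrix n n ℂ) j i := Θ.isHermitian.apply j i

lemma coe_quadForm (Θ : Herm (Fin 2)) (μ ν : ℂ) :
    (quadForm Θ μ ν : ℂ) = (Θ : Matrix (Fin 2) (Fin 2) ℂ) 0 0 * (star μ * μ) +
      (Θ : Matrix (Fin 2) (Fin 2) ℂ) 1 0 * (μ * star ν) +
      (Θ : Matrix (Fin 2) (Fin 2) ℂ) 0 1 * (ν * star μ) +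
      (Θ : Matrix (Fin 2) (Fin 2) ℂ) 1 1 * (star ν * ν) := by
  have := coe_herForm Θ ![μ, ν]
  rw [show quadForm Θ μ ν = herForm Θ ![μ, ν] from rfl, this]
  simp [Matrix.mulVec, dotProduct, Fin.sum_univ_two]
  ring

lemma pencilMap_isHermitian (Θ : Herm (Fin 2)) (F G : Matrix p n ℂ) (X : Herm n) :
    (pencilMap Θ F G X).IsHermitian := by
  have h := Θ.conj_apply
  rw [Matrix.IsHermitian]
  simp only [pencilMap, Matrix.conjTranspose_add, Matrix.conjTranspose_smul,
    Matrix.conjTranspose_mul, Matrix.conjTranspose_conjTranspose, X.isHermitian.eq, h,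
    Matrix.mul_assoc]
  abel

/-- The map `X ↦ pencilMap Θ F G X` as a real linear map between spaces of Hermitian matrices. -/
def pencilHerm (Θ : Herm (Fin 2)) (F G : Matrix p n ℂ) : Herm n →ₗ[ℝ] Herm p where
  toFun X := ⟨pencilMap Θ F G X, pencilMap_isHermitian Θ F G X⟩
  map_add' X Y := by
    apply Subtype.ext
    simp only [pencilMap, AddSubgroup.coe_add, Matrix.mul_add, Matrix.add_mul, smul_add]
    abel
  map_smul' c X := by
    apply Subtype.ext
    simp only [pencilMap, selfAdjoint.val_smul, Matrix.mul_smul, Matrix.smul_mul, smul_add,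
      RingHom.id_apply, smul_comm _ c]

@[simp] lemma coe_pencilHerm (Θ : Herm (Fin 2)) (F G : Matrix p n ℂ) (X : Herm n) :
    (pencilHerm Θ F G X : Matrix p p ℂ) = pencilMap Θ F G X := rfl

lemma primalFeasible_iff (Φ Ψ : Herm (Fin 2)) (F G : Matrix p n ℂ) (X : Herm n) :
    PrimalFeasible Φ Ψ F G X ↔ (∀ a, 0 ≤ herForm X a) ∧ pencilHerm Φ F G X = 0 ∧
      ∀ b, herForm (pencilHerm Ψ F G X) b ≤ 0 := by
  have h := posSemidef_iff_herForm (-pencilHerm Ψ F G X)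
  simp only [herForm_neg, Left.nonneg_neg_iff] at h
  rw [PrimalFeasible, posSemidef_iff_herForm, ← h]
  exact and_congr_right' (and_congr_left' (by rw [Subtype.ext_iff]; rfl))

lemma PrimalFeasible.add {Φ Ψ : Herm (Fin 2)} {F G : Matrix p n ℂ} {X Y : Herm n}
    (hX : PrimalFeasible Φ Ψ F G X) (hY : PrimalFeasible Φ Ψ F G Y) :
    PrimalFeasible Φ Ψ F G (X + Y) := by
  rw [primalFeasible_iff] at *
  refine ⟨fun a => ?_, by rw [map_add, hX.2.1, hY.2.1, add_zero], fun b => ?_⟩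
  · rw [herForm_add]; exact add_nonneg (hX.1 a) (hY.1 a)
  · rw [map_add, herForm_add]; exact add_nonpos (hX.2.2 b) (hY.2.2 b)

lemma PrimalFeasible.smul {Φ Ψ : Herm (Fin 2)} {F G : Matrix p n ℂ} {X : Herm n} {c : ℝ}
    (hc : 0 ≤ c) (hX : PrimalFeasible Φ Ψ F G X) : PrimalFeasible Φ Ψ F G (c • X) := by
  rw [primalFeasible_iff] at *
  refine ⟨fun a => ?_, by rw [map_smul, hX.2.1, smul_zero], fun b => ?_⟩
  · rw [herForm_smul]; exact mul_nonneg hc (hX.1 a)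
  · rw [map_smul, herForm_smul]; exact mul_nonpos_of_nonneg_of_nonpos hc (hX.2.2 b)

lemma PrimalFeasible.zero (Φ Ψ : Herm (Fin 2)) (F G : Matrix p n ℂ) :
    PrimalFeasible Φ Ψ F G 0 := by
  simp [primalFeasible_iff]

/-- A kernel vector `a` of `μ G - ν F` satisfies `F a = μ s` and `G a = ν s` for some `s`. -/
lemma exists_direction {F G : Matrix p n ℂ} {x : ℂ × ℂ} {a : n → ℂ} (hx : x ≠ 0)
    (h : (x.1 • G - x.2 • F) *ᵥ a = 0) : ∃ s, F *ᵥ a = x.1 • s ∧ G *ᵥ a = x.2 • s := by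
  rw [Matrix.sub_mulVec, Matrix.smul_mulVec, Matrix.smul_mulVec, sub_eq_zero] at h
  by_cases h1 : x.1 = 0
  · have h2 : x.2 ≠ 0 := fun h2 => hx (Prod.ext h1 h2)
    refine ⟨x.2⁻¹ • G *ᵥ a, ?_, by rw [smul_smul, mul_inv_cancel₀ h2, one_smul]⟩
    rw [smul_comm, h, smul_smul, inv_mul_cancel₀ h2, one_smul]
  · refine ⟨x.1⁻¹ • F *ᵥ a, by rw [smul_smul, mul_inv_cancel₀ h1, one_smul], ?_⟩
    rw [smul_comm, ← h, smul_smul, inv_mul_cancel₀ h1, one_smul]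

lemma mul_dyad_mul (K L : Matrix p n ℂ) (a : n → ℂ) :
    K * (dyad a : Matrix n n ℂ) * Lᴴ = Matrix.vecMulVec (K *ᵥ a) (star (L *ᵥ a)) := by
  rw [coe_dyad, Matrix.mul_vecMulVec, Matrix.vecMulVec_mul, Matrix.star_mulVec]

/-- With `F a` and `G a` proportional to one vector, the four terms share the factor `s sᴴ`. This
links the scalar conditions defining `𝒞` to the matrix constraints. -/
lemma pencilHerm_dyad (Θ : Herm (Fin 2)) {F G : Matrix p n ℂ} {a : n → ℂ} {s : p → ℂ} {μ ν : ℂ}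
    (hF : F *ᵥ a = μ • s) (hG : G *ᵥ a = ν • s) :
    pencilHerm Θ F G (dyad a) = quadForm Θ μ ν • dyad s := by
  apply Subtype.ext
  rw [coe_pencilHerm, selfAdjoint.val_smul, ← Complex.coe_smul, coe_quadForm]
  ext i j
  simp only [pencilMap, mul_dyad_mul, hF, hG]
  simp only [coe_dyad, Matrix.add_apply, Matrix.smul_apply,
    Matrix.vecMulVec_apply, Pi.smul_apply, Pi.star_apply, smul_eq_mul, star_mul']
  ring

lemma PrimalFeasible.dyad {Φ Ψ : Herm (Fin 2)} {F G : Matrix p n ℂ} {a : n → ℂ}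
    (ha : a ∈ dict Φ Ψ F G) : PrimalFeasible Φ Ψ F G (dyad a) := by
  obtain ⟨x, ⟨hx0, hxΦ, hxΨ⟩, hxa⟩ := ha
  obtain ⟨s, hF, hG⟩ := exists_direction hx0 hxa
  rw [primalFeasible_iff, pencilHerm_dyad Φ hF hG, pencilHerm_dyad Ψ hF hG, hxΦ, zero_smul]
  refine ⟨(posSemidef_iff_herForm _).1 (dyad_posSemidef a), rfl, fun b => ?_⟩
  rw [herForm_smul]
  exact mul_nonpos_of_nonpos_of_nonneg hxΨ
    ((posSemidef_iff_herForm _).1 (dyad_posSemidef s) b)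

lemma PrimalFeasible.sum_dyad {Φ Ψ : Herm (Fin 2)} {F G : Matrix p n ℂ} {ι : Type*}
    (s : Finset ι) {a : ι → n → ℂ} (ha : ∀ i, a i ∈ dict Φ Ψ F G) :
    PrimalFeasible Φ Ψ F G (∑ i ∈ s, SymGauge.dyad (a i)) :=
  Finset.sum_induction _ _ (fun _ _ => PrimalFeasible.add) (PrimalFeasible.zero Φ Ψ F G)
    fun i _ => PrimalFeasible.dyad (ha i)

lemma smul_mem_dict {Φ Ψ : Herm (Fin 2)} {F G : Matrix p n ℂ} {a : n → ℂ} (c : ℂ)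
    (ha : a ∈ dict Φ Ψ F G) : c • a ∈ dict Φ Ψ F G := by
  obtain ⟨x, hx, hxa⟩ := ha
  exact ⟨x, hx, by rw [Matrix.mulVec_smul, hxa, smul_zero]⟩

lemma herForm_smul_right (Z : Herm n) (c : ℝ) (a : n → ℂ) :
    herForm Z ((c : ℂ) • a) = c ^ 2 * herForm Z a := by
  rw [← trInner_dyad, dyad_smul, trInner_smul_left, trInner_dyad]

lemma normSqE_smul (E : Matrix q n ℂ) (c : ℝ) (a : n → ℂ) :
    normSqE E ((c : ℂ) • a) = c ^ 2 * normSqE E a := by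
  rw [← herForm_gram, herForm_smul_right, herForm_gram]

/-- The adjoint of the pencil map. -/
lemma trInner_stack (Θ : Herm (Fin 2)) (F G : Matrix p n ℂ) (X : Herm n) (P : Herm p) :
    ((X : Matrix n n ℂ) * ((stack F G)ᴴ * ((Θ : Matrix (Fin 2) (Fin 2) ℂ) ⊗ₖ
      (P : Matrix p p ℂ)) * stack F G)).trace.re = trInner P (pencilHerm Θ F G X) := by
  have h : (stack F G)ᴴ * ((Θ : Matrix (Fin 2) (Fin 2) ℂ) ⊗ₖ (P : Matrix p p ℂ)) * stack F G =
      (Θ : Matrix (Fin 2) (Fin 2) ℂ) 0 0 • (Fᴴ * (P : Matrix p p ℂ) * F) +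
      (Θ : Matrix (Fin 2) (Fin 2) ℂ) 0 1 • (Fᴴ * (P : Matrix p p ℂ) * G) +
      (Θ : Matrix (Fin 2) (Fin 2) ℂ) 1 0 • (Gᴴ * (P : Matrix p p ℂ) * F) +
      (Θ : Matrix (Fin 2) (Fin 2) ℂ) 1 1 • (Gᴴ * (P : Matrix p p ℂ) * G) := by
    ext i j
    simp only [Matrix.mul_apply, Fintype.sum_prod_type, Fin.sum_univ_two, stack,
      Matrix.conjTranspose_apply, Matrix.of_apply, Matrix.kroneckerMap_apply, Matrix.add_apply,
      Matrix.smul_apply, smul_eq_mul, Finset.sum_mul, Finset.mul_sum, Matrix.cons_val_zero,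
      Matrix.cons_val_one, add_mul, ← Finset.sum_add_distrib]
    refine Finset.sum_congr rfl fun y _ => Finset.sum_congr rfl fun x _ => ?_
    ring
  -- Cyclicity of the trace exchanges the roles of `K` and `L`; this is why `Θ₀₁` multiplies `Fᴴ P
  -- G` here but `G X Fᴴ` in the pencil map.
  have key : ∀ K L : Matrix p n ℂ, ((X : Matrix n n ℂ) * (Kᴴ * (P : Matrix p p ℂ) * L)).trace =
      ((P : Matrix p p ℂ) * (L * (X : Matrix n n ℂ) * Kᴴ)).trace := fun K L => by
    rw [Matrix.trace_mul_comm, Matrix.mul_assoc, Matrix.mul_assoc, Matrix.trace_mul_comm,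
      Matrix.mul_assoc, Matrix.mul_assoc]
  rw [h, trInner, coe_pencilHerm]
  simp only [pencilMap, Matrix.mul_add, Matrix.mul_smul, Matrix.trace_add, Matrix.trace_smul, key]
  congr 1
  ring

end pencils

/-! ### Self-adjoint extension of a symmetric relation, and diagonal dyads. -/

section factorization

set_option linter.unusedSectionVars false

/-- A symmetric linear relation `{(d x, c x)}` has a self-adjoint extension in which the orthogonal
complement of the range of `d` is the multivalued part: in some orthonormal basis it is
diagonal. If the relation is nonnegative, then so is the extension. -/
lemma exists_diagonal_extension {V E : Type*} [AddCommGroup V] [Module ℂ V]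
    [NormedAddCommGroup E] [InnerProductSpace ℂ E] [FiniteDimensional ℂ E] (c d : V →ₗ[ℂ] E)
    (hcd : ∀ x y, inner ℂ (c x) (d y) = inner ℂ (d x) (c y)) :
    ∃ (ι : Type) (_ : Fintype ι) (w : ι → E),
      ∑ i, InnerProductSpace.rankOne ℂ (w i) (w i) = .id ℂ E ∧
      ∀ i, (∀ x, inner ℂ (d x) (w i) = 0) ∨
        ∃ t : ℝ, (∀ x, inner ℂ (c x) (w i) = t * inner ℂ (d x) (w i)) ∧
          ((∀ x, 0 ≤ inner ℂ (c x) (d x)) → 0 ≤ t) := by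
  let R : Submodule ℂ E := LinearMap.range d
  obtain ⟨S, hS⟩ : ∃ S : R →ₗ[ℂ] V, d.rangeRestrict ∘ₗ S = LinearMap.id :=
    d.rangeRestrict.exists_rightInverse_of_surjective d.range_rangeRestrict
  have hS' : ∀ u : R, d (S u) = u := fun u =>
    congrArg Subtype.val (LinearMap.congr_fun hS u)
  -- The operator part of the extension: the compression to `R` of the relation, where `S` picks a
  -- preimage under `d`. Compression preserves both symmetry and nonnegativity.
  let H : R →ₗ[ℂ] R := (R.orthogonalProjectionOnto : E →ₗ[ℂ] R) ∘ₗ c ∘ₗ S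
  have hH : ∀ u v : R, inner ℂ (H u) v = inner ℂ (c (S u)) (d (S v)) := by
    intro u v
    rw [hS']
    exact R.inner_orthogonalProjectionOnto_eq_of_mem_right v (c (S u))
  have hsym : H.IsSymmetric := by
    intro u v
    rw [hH, ← inner_conj_symm u, hH, inner_conj_symm, hcd]
  let b := hsym.eigenvectorBasis rfl
  let b' := stdOrthonormalBasis ℂ Rᗮ
  have hb : ∀ i, H (b i) = ((hsym.eigenvalues rfl i : ℝ) : ℂ) • b i := fun i =>
    hsym.apply_eigenvectorBasis rfl i
  refine ⟨_ ⊕ _, inferInstance, Sum.elim (fun i => (b i : E)) (fun j => (b' j : E)), ?_, ?_⟩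
  · rw [Fintype.sum_sum_type]
    simp only [Sum.elim_inl, Sum.elim_inr]
    rw [← b.starProjection_eq_sum_rankOne, ← b'.starProjection_eq_sum_rankOne,
      Submodule.starProjection_orthogonal]
    abel
  · rintro (i | j)
    · refine Or.inr ⟨hsym.eigenvalues rfl i, fun x => ?_, fun hpos => ?_⟩
      · have hx : d x ∈ R := ⟨x, rfl⟩
        have h3 := R.inner_orthogonalProjectionOnto_eq_of_mem_left ⟨d x, hx⟩ (c (S (b i)))
        have h5 : R.orthogonalProjectionOnto (c (S (b i))) = H (b i) := rfl
        rw [h5, hb, inner_smul_right] at h3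
        simp only [Sum.elim_inl]
        -- Symmetry moves `c` onto the preimage of the eigenvector; pairing with `d x ∈ R` then sees
        -- only the projection to `R`, that is, `H (b i)`.
        rw [← hS' (b i), hcd, hS', ← h3]
        rfl
      · have h := hpos (S (b i))
        rw [← hH, hb, inner_smul_left, inner_self_eq_norm_sq_to_K, b.norm_eq_one] at h
        simpa using h
    · exact Or.inl fun x => (Submodule.mem_orthogonal _ _).1 (b' j).2 _ ⟨x, rfl⟩

variable {p n q : Type*} [Fintype p] [Fintype n] [Fintype q]

/-- If `C Dᴴ` is Hermitian, then the pair `(C, D)` is diagonal in some orthonormal basis. -/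
lemma exists_simultaneous_diagonalization {r : ℕ} (C D : Matrix p (Fin r) ℂ)
    (h : D * Cᴴ = C * Dᴴ) :
    ∃ (ι : Type) (_ : Fintype ι) (w : ι → Fin r → ℂ),
      ∑ i, Matrix.vecMulVec (w i) (star (w i)) = 1 ∧
      ∀ i, D *ᵥ w i = 0 ∨ ∃ t : ℝ, C *ᵥ w i = (t : ℂ) • D *ᵥ w i ∧
        ((C * Dᴴ).PosSemidef → 0 ≤ t) := by
  classical
  have hK : ∀ (K : Matrix p (Fin r) ℂ) (x : EuclideanSpace ℂ p) (y : EuclideanSpace ℂ (Fin r)),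
      inner ℂ (Matrix.toEuclideanLin Kᴴ x) y = inner ℂ x (Matrix.toEuclideanLin K y) := by
    intro K x y
    rw [Matrix.toEuclideanLin_conjTranspose_eq_adjoint K, LinearMap.adjoint_inner_left]
  have hKL : ∀ (K L : Matrix p (Fin r) ℂ) (y : EuclideanSpace ℂ p),
      Matrix.toEuclideanLin K (Matrix.toEuclideanLin Lᴴ y) =
        Matrix.toEuclideanLin (K * Lᴴ) y := fun K L y => by
    simp [Matrix.toLpLin_apply]
  obtain ⟨ι, _, w, hw, hw'⟩ := exists_diagonal_extension (Matrix.toEuclideanLin Cᴴ)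
    (Matrix.toEuclideanLin Dᴴ) fun x y => by rw [hK, hK, hKL, hKL, h]
  refine ⟨ι, ‹_›, fun i => (w i).ofLp, ?_, fun i => ?_⟩
  · have := congrArg Matrix.toEuclideanLin.symm (congrArg ContinuousLinearMap.toLinearMap hw)
    simp only [ContinuousLinearMap.toLinearMap_sum, map_sum,
      InnerProductSpace.symm_toEuclideanLin_rankOne] at this
    rw [this, LinearEquiv.symm_apply_eq]
    simp
  · refine (hw' i).imp (fun h0 => ?_) fun ⟨t, ht, hpos⟩ => ⟨t, ?_, fun hCD => hpos fun x => ?_⟩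
    · have : Matrix.toEuclideanLin D (w i) = 0 := by
        refine ext_inner_left ℂ fun x => ?_
        rw [← hK, inner_zero_right, h0]
      simpa [Matrix.toLpLin_apply] using this
    · have : Matrix.toEuclideanLin C (w i) = (t : ℂ) • Matrix.toEuclideanLin D (w i) := by
        refine ext_inner_left ℂ fun x => ?_
        rw [inner_smul_right, ← hK, ← hK, ht]
      exact congrArg WithLp.ofLp this
    · rw [hK, hKL]
      have := hCD.dotProduct_mulVec_nonneg x.ofLp
      rw [EuclideanSpace.inner_eq_star_dotProduct, dotProduct_comm]
      exact this

/-- If `F X Gᴴ` is Hermitian and `X` is positive semidefinite, then `X` is a sum of dyads on which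
`(F, G)` acts diagonally. -/
lemma exists_dyad_decomposition (F G : Matrix p n ℂ) (X : Herm n)
    (hX : (X : Matrix n n ℂ).PosSemidef)
    (h : G * (X : Matrix n n ℂ) * Fᴴ = F * (X : Matrix n n ℂ) * Gᴴ) :
    ∃ (r : ℕ) (a : Fin r → n → ℂ), X = ∑ k, dyad (a k) ∧
      ∀ k, G *ᵥ a k = 0 ∨ ∃ t : ℝ, F *ᵥ a k = (t : ℂ) • G *ᵥ a k ∧
        ((F * (X : Matrix n n ℂ) * Gᴴ).PosSemidef → 0 ≤ t) := by
  obtain ⟨m, v, hv⟩ := Matrix.posSemidef_iff_eq_sum_vecMulVec.1 hX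
  -- A factor with `X = Y Yᴴ`. Replacing its columns by `Y wᵢ`, for a resolution of the identity `∑
  -- wᵢ wᵢᴴ = 1`, does not change the sum of dyads.
  let Y : Matrix n (Fin m) ℂ := Matrix.of fun i k => v k i
  have hY : (X : Matrix n n ℂ) = Y * Yᴴ := by
    rw [hv]
    ext i j
    simp [Y, Matrix.mul_apply, Matrix.sum_apply, Matrix.vecMulVec_apply]
  have hmul : ∀ K L : Matrix p n ℂ,
      (K * Y) * (L * Y)ᴴ = K * (X : Matrix n n ℂ) * Lᴴ := fun K L => by
    rw [hY, Matrix.conjTranspose_mul]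
    simp only [Matrix.mul_assoc]
  obtain ⟨ι, _, w, hw, hw'⟩ := exists_simultaneous_diagonalization (F * Y) (G * Y)
    (by rw [hmul, hmul, h])
  let e := Fintype.equivFin ι
  refine ⟨_, fun k => Y *ᵥ w (e.symm k), ?_, fun k => ?_⟩
  · apply Subtype.ext
    have hd : ∀ i, (dyad (Y *ᵥ w i) : Matrix n n ℂ) =
        Y * Matrix.vecMulVec (w i) (star (w i)) * Yᴴ := fun i => (mul_dyad_mul Y Y (w i)).symm
    rw [Herm.coe_sum, e.symm.sum_comp fun i => (dyad (Y *ᵥ w i) : Matrix n n ℂ)]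
    simp_rw [hd]
    rw [← Matrix.sum_mul, ← Matrix.mul_sum, hw, Matrix.mul_one, hY]
  · simpa only [Matrix.mulVec_mulVec, hmul] using hw' (e.symm k)

end factorization

/-! ### Normal form of the curve under a change of basis of `ℂ²`. -/

section normalForm

set_option linter.unusedSectionVars false

variable {p n q : Type*} [Fintype p] [Fintype n] [Fintype q]

/-- The Hermitian matrix `Tᴴ Θ T`. -/
def congruence (T : Matrix (Fin 2) (Fin 2) ℂ) (Θ : Herm (Fin 2)) : Herm (Fin 2) :=
  ⟨Tᴴ * (Θ : Matrix (Fin 2) (Fin 2) ℂ) * T,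
    Matrix.isHermitian_conjTranspose_mul_mul _ Θ.isHermitian⟩

lemma congruence_apply (T : Matrix (Fin 2) (Fin 2) ℂ) (Θ : Herm (Fin 2)) (i j : Fin 2) :
    (congruence T Θ : Matrix (Fin 2) (Fin 2) ℂ) i j =
      star (T 0 i) * ((Θ : Matrix (Fin 2) (Fin 2) ℂ) 0 0 * T 0 j +
        (Θ : Matrix (Fin 2) (Fin 2) ℂ) 0 1 * T 1 j) +
      star (T 1 i) * ((Θ : Matrix (Fin 2) (Fin 2) ℂ) 1 0 * T 0 j +
        (Θ : Matrix (Fin 2) (Fin 2) ℂ) 1 1 * T 1 j) := by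
  simp only [congruence, Matrix.mul_apply, Fin.sum_univ_two, Matrix.conjTranspose_apply]
  ring

lemma congruence_mul (T S : Matrix (Fin 2) (Fin 2) ℂ) (Θ : Herm (Fin 2)) :
    congruence (T * S) Θ = congruence S (congruence T Θ) := by
  apply Subtype.ext
  simp only [congruence, Matrix.conjTranspose_mul, Matrix.mul_assoc]

lemma quadForm_congruence (T : Matrix (Fin 2) (Fin 2) ℂ) (Θ : Herm (Fin 2)) (α β : ℂ) :
    quadForm (congruence T Θ) α β =
      quadForm Θ (T 0 0 * α + T 0 1 * β) (T 1 0 * α + T 1 1 * β) := by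
  apply Complex.ofReal_injective
  rw [coe_quadForm, coe_quadForm]
  simp only [congruence_apply, star_add, star_mul']
  ring

lemma quadForm_eq_re (Θ : Herm (Fin 2)) (μ ν : ℂ) :
    quadForm Θ μ ν = ((Θ : Matrix (Fin 2) (Fin 2) ℂ) 0 0).re * Complex.normSq μ +
      ((Θ : Matrix (Fin 2) (Fin 2) ℂ) 1 1).re * Complex.normSq ν +
      2 * ((Θ : Matrix (Fin 2) (Fin 2) ℂ) 0 1 * (ν * star μ)).re := by
  have h := congrArg Complex.re (coe_quadForm Θ μ ν)
  rw [← Θ.conj_apply 0 1] at h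
  simp [Complex.normSq_apply] at h ⊢
  linear_combination h

lemma pencilMap_congruence (T : Matrix (Fin 2) (Fin 2) ℂ) (Θ : Herm (Fin 2)) (C D : Matrix p n ℂ)
    (X : Herm n) :
    pencilMap Θ (T 0 0 • C + T 0 1 • D) (T 1 0 • C + T 1 1 • D) X =
      pencilMap (congruence T Θ) C D X := by
  simp only [pencilMap, congruence_apply, Matrix.add_mul, Matrix.mul_add, Matrix.smul_mul,
    Matrix.mul_smul, Matrix.conjTranspose_add, Matrix.conjTranspose_smul, smul_add]
  module

/-- If `(α, β)` is a point of the transformed curve, then `T (α, β)` is a point of the original one,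
and the pencil there is `det T` times the transformed pencil. -/
lemma dict_congruence_subset {T : Matrix (Fin 2) (Fin 2) ℂ} (hT : T.det ≠ 0) (Φ Ψ : Herm (Fin 2))
    (C D : Matrix p n ℂ) :
    dict (congruence T Φ) (congruence T Ψ) C D ⊆
      dict Φ Ψ (T 0 0 • C + T 0 1 • D) (T 1 0 • C + T 1 1 • D) := by
  rintro a ⟨⟨α, β⟩, ⟨h0, hΦ, hΨ⟩, ha⟩
  refine ⟨(T 0 0 * α + T 0 1 * β, T 1 0 * α + T 1 1 * β),
    ⟨?_, by rw [← hΦ, quadForm_congruence], by rwa [quadForm_congruence] at hΨ⟩, ?_⟩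
  · intro h
    rw [Prod.ext_iff] at h
    obtain ⟨h1, h2⟩ := h
    simp only [Prod.fst_zero, Prod.snd_zero] at h1 h2
    rw [Matrix.det_fin_two] at hT
    refine h0 (Prod.ext ?_ ?_)
    · exact (mul_eq_zero_iff_left hT).1 (by linear_combination T 1 1 * h1 - T 0 1 * h2)
    · exact (mul_eq_zero_iff_left hT).1 (by linear_combination T 0 0 * h2 - T 1 0 * h1)
  · have : (T 0 0 * α + T 0 1 * β) • (T 1 0 • C + T 1 1 • D) -
        (T 1 0 * α + T 1 1 * β) • (T 0 0 • C + T 0 1 • D) = T.det • (α • D - β • C) := by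
      rw [Matrix.det_fin_two]
      module
    simp only at ha ⊢
    rw [this, Matrix.smul_mulVec, ha, smul_zero]

lemma exists_eq_combination {T : Matrix (Fin 2) (Fin 2) ℂ} (hT : T.det ≠ 0) {M : Type*}
    [AddCommGroup M] [Module ℂ M] (F G : M) :
    ∃ C D : M, F = T 0 0 • C + T 0 1 • D ∧ G = T 1 0 • C + T 1 1 • D := by
  have h : T.det⁻¹ * (T 0 0 * T 1 1 - T 0 1 * T 1 0) = 1 := by
    rw [← Matrix.det_fin_two, inv_mul_cancel₀ hT]
  refine ⟨T.det⁻¹ • (T 1 1 • F - T 0 1 • G), T.det⁻¹ • (T 0 0 • G - T 1 0 • F), ?_, ?_⟩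
  · match_scalars
    · linear_combination -h
    · ring
  · match_scalars
    · linear_combination -h
    · ring

/-- `Θ` has zero diagonal and upper right entry `z`. -/
def IsAntidiagonal (Θ : Herm (Fin 2)) (z : ℂ) : Prop :=
  (Θ : Matrix (Fin 2) (Fin 2) ℂ) 0 0 = 0 ∧ (Θ : Matrix (Fin 2) (Fin 2) ℂ) 1 1 = 0 ∧
    (Θ : Matrix (Fin 2) (Fin 2) ℂ) 0 1 = z

lemma IsAntidiagonal.quadForm {Θ : Herm (Fin 2)} {z : ℂ} (h : IsAntidiagonal Θ z) (μ ν : ℂ) :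
    quadForm Θ μ ν = 2 * (z * (ν * star μ)).re := by
  rw [quadForm_eq_re, h.1, h.2.1, h.2.2]
  simp

lemma IsAntidiagonal.pencilMap {Θ : Herm (Fin 2)} {z : ℂ} (h : IsAntidiagonal Θ z)
    (C D : Matrix p n ℂ) (X : Herm n) :
    pencilMap Θ C D X = star z • (C * (X : Matrix n n ℂ) * Dᴴ) +
      z • (D * (X : Matrix n n ℂ) * Cᴴ) := by
  simp only [SymGauge.pencilMap, ← Θ.conj_apply 0 1]
  rw [h.1, h.2.1, h.2.2]
  simp

/-- Two points of the curve span a basis of `ℂ²` in which `Φ` is a multiple of `[0, i; -i, 0]`. -/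
lemma exists_antidiagonal {Φ Ψ : Herm (Fin 2)} (hΦ : (Φ : Matrix (Fin 2) (Fin 2) ℂ).det.re < 0)
    (hC : IsOneDimensional Φ Ψ) :
    ∃ (T : Matrix (Fin 2) (Fin 2) ℂ) (c : ℝ), T.det ≠ 0 ∧ c ≠ 0 ∧
      IsAntidiagonal (congruence T Φ) (c * Complex.I) ∧
      ((congruence T Ψ : Matrix (Fin 2) (Fin 2) ℂ) 0 0).re ≤ 0 ∧
      ((congruence T Ψ : Matrix (Fin 2) (Fin 2) ℂ) 1 1).re ≤ 0 ∧
      0 ≤ ((congruence T Ψ : Matrix (Fin 2) (Fin 2) ℂ) 0 1).re := by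
  obtain ⟨x, ⟨-, hxΦ, hxΨ⟩, y, ⟨-, hyΦ, hyΨ⟩, hxy⟩ := hC
  -- The columns are the two points of `𝒞`, so the diagonal of a transformed form consists of its
  -- values there: zero for `Φ`, nonpositive for `Ψ`.
  let T := !![x.1, y.1; x.2, y.2]
  have hT : T.det ≠ 0 := by
    rw [Matrix.det_fin_two_of]
    intro h
    exact hxy (by linear_combination h)
  have h00 : ∀ Θ, quadForm Θ x.1 x.2 = ((congruence T Θ : Matrix (Fin 2) (Fin 2) ℂ) 0 0).re :=
    fun Θ => by
      have := quadForm_congruence T Θ 1 0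
      rw [quadForm_eq_re] at this
      simpa [T] using this.symm
  have h11 : ∀ Θ, quadForm Θ y.1 y.2 = ((congruence T Θ : Matrix (Fin 2) (Fin 2) ℂ) 1 1).re :=
    fun Θ => by
      have := quadForm_congruence T Θ 0 1
      rw [quadForm_eq_re] at this
      simpa [T] using this.symm
  have him : ∀ (Θ : Herm (Fin 2)) i, ((Θ : Matrix (Fin 2) (Fin 2) ℂ) i i).im = 0 := fun Θ i =>
    Complex.conj_eq_iff_im.1 (Θ.conj_apply i i)
  have hΦ00 : (congruence T Φ : Matrix (Fin 2) (Fin 2) ℂ) 0 0 = 0 :=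
    Complex.ext (by rw [← h00, hxΦ]; rfl) (him _ _)
  have hΦ11 : (congruence T Φ : Matrix (Fin 2) (Fin 2) ℂ) 1 1 = 0 :=
    Complex.ext (by rw [← h11, hyΦ]; rfl) (him _ _)
  set φ := (congruence T Φ : Matrix (Fin 2) (Fin 2) ℂ) 0 1 with hφ
  have hφ0 : φ ≠ 0 := by
    intro h0
    have hdet : (congruence T Φ : Matrix (Fin 2) (Fin 2) ℂ).det = 0 := by
      rw [Matrix.det_fin_two, hΦ00, ← hφ, h0]
      simp
    simp only [congruence, Matrix.det_mul, Matrix.det_conjTranspose] at hdet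
    have : (Φ : Matrix (Fin 2) (Fin 2) ℂ).det = 0 := by simpa [hT] using hdet
    rw [this] at hΦ
    simp at hΦ
  -- Scaling the second column by `w = σ i / φ` makes the corner entry of `Φ` equal to `σ i`. The
  -- sign of `σ` is still free and serves to make the real part of the corner entry of `Ψ`
  -- nonnegative.
  obtain ⟨σ, hσ, hσΨ⟩ : ∃ σ : ℝ, σ ≠ 0 ∧
      0 ≤ σ * ((congruence T Ψ : Matrix (Fin 2) (Fin 2) ℂ) 0 1 * (Complex.I / φ)).re := by
    rcases le_total 0 ((congruence T Ψ : Matrix (Fin 2) (Fin 2) ℂ) 0 1 * (Complex.I / φ)).re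
      with h | h
    · exact ⟨1, one_ne_zero, by linarith⟩
    · exact ⟨-1, by norm_num, by linarith⟩
  let w : ℂ := σ * (Complex.I / φ)
  have hw : w ≠ 0 := by simp [w, hσ, hφ0]
  let S : Matrix (Fin 2) (Fin 2) ℂ := !![1, 0; 0, w]
  have hS : ∀ Θ : Herm (Fin 2), (congruence S Θ : Matrix (Fin 2) (Fin 2) ℂ) 0 0 =
        (Θ : Matrix (Fin 2) (Fin 2) ℂ) 0 0 ∧
      (congruence S Θ : Matrix (Fin 2) (Fin 2) ℂ) 1 1 =
        Complex.normSq w * (Θ : Matrix (Fin 2) (Fin 2) ℂ) 1 1 ∧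
      (congruence S Θ : Matrix (Fin 2) (Fin 2) ℂ) 0 1 =
        (Θ : Matrix (Fin 2) (Fin 2) ℂ) 0 1 * w := fun Θ => by
    simp only [congruence_apply, Complex.normSq_eq_conj_mul_self]
    simp [S]
    ring
  refine ⟨T * S, σ, ?_, hσ, ?_, ?_, ?_, ?_⟩
  · rw [Matrix.det_mul]
    refine mul_ne_zero hT ?_
    simpa [S] using hw
  · rw [congruence_mul, IsAntidiagonal, (hS _).1, (hS _).2.1, (hS _).2.2, hΦ00, hΦ11, ← hφ]
    refine ⟨rfl, mul_zero _, ?_⟩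
    simp only [w]
    field_simp
  · rw [congruence_mul, (hS _).1, ← h00]
    exact hxΨ
  · rw [congruence_mul, (hS _).2.1, Complex.re_ofReal_mul, ← h11]
    exact mul_nonpos_of_nonneg_of_nonpos (Complex.normSq_nonneg _) hyΨ
  · rw [congruence_mul, (hS _).2.2, ← mul_assoc, mul_comm _ (σ : ℂ), mul_assoc,
      Complex.re_ofReal_mul]
    exact hσΨ

/-- In a suitable basis of `ℂ²`, the zero set of `Φ` is the real line, and the inequality given by
`Ψ` is redundant or describes the nonnegative half-line. -/
lemma exists_normalForm {Φ Ψ : Herm (Fin 2)} (hΦ : (Φ : Matrix (Fin 2) (Fin 2) ℂ).det.re < 0)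
    (hC : IsOneDimensional Φ Ψ) :
    ∃ (T : Matrix (Fin 2) (Fin 2) ℂ) (c : ℝ), T.det ≠ 0 ∧ c ≠ 0 ∧
      IsAntidiagonal (congruence T Φ) (c * Complex.I) ∧
      ((∀ μ ν, quadForm Φ μ ν = 0 → quadForm Ψ μ ν ≤ 0) ∨
        ∃ z : ℂ, z.re < 0 ∧ IsAntidiagonal (congruence T Ψ) z) := by
  obtain ⟨T, c, hT, hc, hΦT, ha, hd, hb⟩ := exists_antidiagonal hΦ hC
  set a := ((congruence T Ψ : Matrix (Fin 2) (Fin 2) ℂ) 0 0).re with ha'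
  set d := ((congruence T Ψ : Matrix (Fin 2) (Fin 2) ℂ) 1 1).re with hd'
  set b := ((congruence T Ψ : Matrix (Fin 2) (Fin 2) ℂ) 0 1) with hb'
  -- On the zero set of `Φ` the product `β ᾱ` is real, so `q_Ψ` behaves as the real binary form `a
  -- x² + 2 (re b) x y + d y²`. As `a, d ≤ 0`, it is nonpositive when its discriminant is not
  -- positive.
  by_cases hdisc : b.re ^ 2 ≤ a * d
  · refine ⟨T, c, hT, hc, hΦT, Or.inl fun μ ν h => ?_⟩
    obtain ⟨α, β, rfl, rfl⟩ := exists_eq_combination hT μ ν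
    simp only [smul_eq_mul] at h ⊢
    rw [← quadForm_congruence, hΦT.quadForm] at h
    rw [← quadForm_congruence, quadForm_eq_re, ← ha', ← hd', ← hb']
    have him : (β * star α).im = 0 := by
      simp [hc] at h ⊢
      linarith
    have hre : (b * (β * star α)).re = b.re * (β * star α).re := by
      rw [Complex.mul_re, him]; ring
    have hn : (β * star α).re ^ 2 = Complex.normSq α * Complex.normSq β := by
      have := Complex.normSq_apply (β * star α)
      rw [him, map_mul] at this
      simp only [Complex.star_def, Complex.normSq_conj] at this ⊢
      linarith
    rw [hre]
    set t := (β * star α).re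
    have hA := Complex.normSq_nonneg α
    have hB := Complex.normSq_nonneg β
    refine le_of_not_gt fun hlt => ?_
    have h1 : 0 ≤ -(a * Complex.normSq α + d * Complex.normSq β) := by
      nlinarith
    have h2 : (a * Complex.normSq α + d * Complex.normSq β) ^ 2 < (2 * (b.re * t)) ^ 2 := by
      rw [← neg_sq (a * _ + _)]
      exact pow_lt_pow_left₀ (by linarith) h1 two_ne_zero
    have h3 : (b.re * t) ^ 2 ≤ (a * d) * (Complex.normSq α * Complex.normSq β) := by
      rw [mul_pow, hn]
      gcongr
    nlinarith [sq_nonneg (a * Complex.normSq α - d * Complex.normSq β)]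
  · push Not at hdisc
    let κ := √(b.re ^ 2 - a * d)
    have hκ : κ ^ 2 = b.re ^ 2 - a * d := Real.sq_sqrt (by linarith)
    have hκ0 : 0 < κ := Real.sqrt_pos.2 (by linarith)
    -- The columns are two real isotropic vectors of the indefinite binary form, so the diagonal of
    -- `Ψ` vanishes in the new basis. Because `S` is real, it only multiplies `Φ` by `det S = 2 κ (κ
    -- + re b)`, which is positive since `re b ≥ 0`. The real part of the corner entry of `Ψ`
    -- becomes `-2 κ² (κ + re b)`.
    let S : Matrix (Fin 2) (Fin 2) ℂ := !![(d : ℂ), (b.re + κ : ℝ); (-(b.re + κ) : ℝ), (-a : ℝ)]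
    have hSdet : S.det = ((2 * κ * (κ + b.re) : ℝ) : ℂ) := by
      rw [Matrix.det_fin_two_of]
      norm_cast
      linear_combination -hκ
    have hpos : 0 < 2 * κ * (κ + b.re) := by positivity
    have him : ∀ (Θ : Herm (Fin 2)) i, ((Θ : Matrix (Fin 2) (Fin 2) ℂ) i i) =
        (((Θ : Matrix (Fin 2) (Fin 2) ℂ) i i).re : ℂ) := fun Θ i =>
      (Complex.conj_eq_iff_re.1 (Θ.conj_apply i i)).symm
    refine ⟨T * S, 2 * κ * (κ + b.re) * c, ?_, ?_, ?_, Or.inr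
      ⟨(congruence (T * S) Ψ : Matrix (Fin 2) (Fin 2) ℂ) 0 1, ?_, ?_, ?_, rfl⟩⟩
    · rw [Matrix.det_mul, hSdet]
      exact mul_ne_zero hT (by exact_mod_cast hpos.ne')
    · exact mul_ne_zero hpos.ne' hc
    · rw [congruence_mul]
      have h10 := (congruence T Φ).conj_apply 0 1
      rw [hΦT.2.2] at h10
      rw [Matrix.det_fin_two] at hSdet
      refine ⟨?_, ?_, ?_⟩ <;> rw [congruence_apply, hΦT.1, hΦT.2.1, hΦT.2.2, ← h10]
      · simp [S]; ring
      · simp [S]; ring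
      · push_cast at hSdet ⊢
        rw [← hSdet]
        simp [S]; ring
    all_goals
      rw [congruence_mul, congruence_apply, him _ 0, him _ 1,
        ← (congruence T Ψ).conj_apply 0 1, ← ha', ← hd', ← hb']
    · simp [S]
      nlinarith [mul_pos (mul_pos hκ0 hκ0) (show 0 < κ + b.re by positivity)]
    · apply Complex.ext
      · simp [S]
        linear_combination d * hκ
      · simp [S]; ring
    · apply Complex.ext
      · simp [S]
        linear_combination a * hκ
      · simp [S]; ring

end normalForm

/-! ### Dyadic decomposition of feasible matrices and the value of the gauge. -/

section gauge

set_option linter.unusedSectionVars false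

variable {p n q : Type*} [Fintype p] [Fintype n] [Fintype q]

/-- A feasible matrix is a sum of dyads of elements of `𝒜`. -/
theorem exists_dict_decomposition {Φ Ψ : Herm (Fin 2)}
    (hΦ : (Φ : Matrix (Fin 2) (Fin 2) ℂ).det.re < 0) (hC : IsOneDimensional Φ Ψ)
    {F G : Matrix p n ℂ} {X : Herm n} (hX : PrimalFeasible Φ Ψ F G X) :
    ∃ (r : ℕ) (a : Fin r → n → ℂ), (∀ k, a k ∈ dict Φ Ψ F G) ∧ X = ∑ k, dyad (a k) := by
  obtain ⟨T, c, hT, hc, hΦT, hΨT⟩ := exists_normalForm hΦ hC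
  obtain ⟨C, D, rfl, rfl⟩ := exists_eq_combination hT F G
  obtain ⟨hpsd, hXΦ, hXΨ⟩ := hX
  rw [pencilMap_congruence, hΦT.pencilMap] at hXΦ
  have hDC : D * (X : Matrix n n ℂ) * Cᴴ = C * (X : Matrix n n ℂ) * Dᴴ := by
    have hcI : (c * Complex.I : ℂ) ≠ 0 := by simp [hc]
    have hs : star (c * Complex.I : ℂ) = -(c * Complex.I) := by simp
    rw [hs, neg_smul, neg_add_eq_zero] at hXΦ
    exact (smul_right_injective _ hcI hXΦ).symm
  obtain ⟨r, a, hXa, ha⟩ := exists_dyad_decomposition C D X hpsd hDC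
  refine ⟨r, a, fun k => dict_congruence_subset hT Φ Ψ C D ?_, hXa⟩
  rcases ha k with h0 | ⟨t, ht, hpos⟩
  -- The multivalued part of the extension corresponds to the point at infinity.
  · refine ⟨(1, 0), ⟨by simp, by simp [hΦT.quadForm], ?_⟩, by simp [h0]⟩
    rcases hΨT with hR | ⟨z, -, hz⟩
    · rw [quadForm_congruence]
      refine hR _ _ ?_
      rw [← quadForm_congruence]
      simp [hΦT.quadForm]
    · simp [hz.quadForm]
  · refine ⟨(t, 1), ⟨by simp, by simp [hΦT.quadForm], ?_⟩, by
      simp [Matrix.sub_mulVec, Matrix.smul_mulVec, ht]⟩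
    rcases hΨT with hR | ⟨z, hz0, hz⟩
    · rw [quadForm_congruence]
      refine hR _ _ ?_
      rw [← quadForm_congruence]
      simp [hΦT.quadForm]
    · have ht0 : 0 ≤ t := by
        refine hpos ?_
        -- Since `C X Dᴴ` is Hermitian, only the real part of `z` survives, and the constraint from
        -- `Ψ` says that `C X Dᴴ` is positive semidefinite.
        have h1 : -pencilMap (congruence T Ψ) C D X =
            ((-(2 * z.re) : ℝ) : ℂ) • (C * (X : Matrix n n ℂ) * Dᴴ) := by
          rw [hz.pencilMap, hDC, ← add_smul, ← neg_smul]
          congr 1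
          apply Complex.ext <;> simp
          ring
        rw [pencilMap_congruence, h1] at hXΨ
        have h2 := hXΨ.smul (a := (((-(2 * z.re))⁻¹ : ℝ) : ℂ))
          (by exact_mod_cast (inv_pos.2 (by linarith)).le)
        rwa [smul_smul, ← Complex.ofReal_mul, inv_mul_cancel₀ (by linarith), Complex.ofReal_one,
          one_smul] at h2
      rw [hz.quadForm]
      simp
      nlinarith

/-- Both properties define convex sets and hold for atoms. They yield the lower bound on the gauge
and its infinite value off the feasible cone. -/
lemma mem_convexHull_atoms {Φ Ψ : Herm (Fin 2)} {F G : Matrix p n ℂ} {E : Matrix q n ℂ}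
    {y : Herm n} (hy : y ∈ convexHull ℝ (atoms Φ Ψ F G E)) :
    PrimalFeasible Φ Ψ F G y ∧ trInner y (gram E) ≤ 1 := by
  have hconv : Convex ℝ {y : Herm n | PrimalFeasible Φ Ψ F G y ∧ trInner y (gram E) ≤ 1} := by
    rintro y ⟨hy, hy1⟩ z ⟨hz, hz1⟩ s t hs ht hst
    refine ⟨(hy.smul hs).add (hz.smul ht), ?_⟩
    rw [trInner_add_left, trInner_smul_left, trInner_smul_left]
    nlinarith
  refine convexHull_min ?_ hconv hy
  rintro X ⟨a, ha, ha1, rfl⟩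
  refine ⟨PrimalFeasible.dyad ha, ?_⟩
  rw [trInner_dyad, herForm_gram, normSqE]
  exact pow_le_one₀ (norm_nonneg _) ha1

lemma normSqE_nonneg (E : Matrix q n ℂ) (a : n → ℂ) : 0 ≤ normSqE E a := sq_nonneg _

-- Rescaling `a` gives an atom. The slack `ε` is needed because `E a` may vanish for a nonzero `a`,
-- and then the weight `‖E a‖²` itself does not suffice.
open scoped Pointwise in
lemma dyad_mem_smul_convexHull {Φ Ψ : Herm (Fin 2)} {F G : Matrix p n ℂ} {E : Matrix q n ℂ}
    {a : n → ℂ} (ha : a ∈ dict Φ Ψ F G) {ε : ℝ} (hε : 0 < ε) :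
    dyad a ∈ (normSqE E a + ε) • convexHull ℝ (atoms Φ Ψ F G E) := by
  have hpos : 0 < normSqE E a + ε := add_pos_of_nonneg_of_pos (normSqE_nonneg E a) hε
  have hs : (√(normSqE E a + ε))⁻¹ ^ 2 = (normSqE E a + ε)⁻¹ := by
    rw [inv_pow, Real.sq_sqrt hpos.le]
  refine ⟨dyad ((((√(normSqE E a + ε))⁻¹ : ℝ) : ℂ) • a), subset_convexHull ℝ _
    ⟨_, smul_mem_dict _ ha, ?_, rfl⟩, ?_⟩
  · have : normSqE E ((((√(normSqE E a + ε))⁻¹ : ℝ) : ℂ) • a) ≤ 1 := by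
      rw [normSqE_smul, hs, inv_mul_le_one₀ hpos]
      linarith
    rw [normSqE] at this
    exact (sq_le_one_iff₀ (norm_nonneg _)).1 this
  · simp only
    rw [dyad_smul, hs, smul_smul, mul_inv_cancel₀ hpos.ne', one_smul]

open scoped Pointwise in
lemma sum_dyad_mem_smul_convexHull {Φ Ψ : Herm (Fin 2)} {F G : Matrix p n ℂ} {E : Matrix q n ℂ}
    (h0 : (0 : n → ℂ) ∈ dict Φ Ψ F G) {r : ℕ}
    {a : Fin r → n → ℂ} (ha : ∀ k, a k ∈ dict Φ Ψ F G) {ε : ℝ} (hε : 0 < ε) :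
    ∑ k, dyad (a k) ∈ (∑ k, (normSqE E (a k) + ε)) • convexHull ℝ (atoms Φ Ψ F G E) := by
  have hne : (convexHull ℝ (atoms Φ Ψ F G E)).Nonempty :=
    ⟨_, subset_convexHull ℝ _ ⟨0, h0, by simp, rfl⟩⟩
  -- Induction on matrix and weight together: for a convex set `K`, `(s + t) K = s K + t K` requires
  -- `s, t ≥ 0`. The empty sum uses that the hull is nonempty.
  have key : 0 ≤ (∑ k, (dyad (a k), normSqE E (a k) + ε)).2 ∧
      (∑ k, (dyad (a k), normSqE E (a k) + ε)).1 ∈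
        (∑ k, (dyad (a k), normSqE E (a k) + ε)).2 • convexHull ℝ (atoms Φ Ψ F G E) := by
    refine Finset.sum_induction _
      (fun y : Herm n × ℝ => 0 ≤ y.2 ∧ y.1 ∈ y.2 • convexHull ℝ (atoms Φ Ψ F G E)) ?_ ?_ ?_
    · rintro ⟨y, s⟩ ⟨z, t⟩ ⟨hs, hy⟩ ⟨ht, hz⟩
      refine ⟨add_nonneg hs ht, ?_⟩
      simp only [Prod.mk_add_mk]
      rw [(convex_convexHull ℝ _).add_smul hs ht]
      exact Set.add_mem_add hy hz
    · refine ⟨le_rfl, ?_⟩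
      simp [Set.zero_smul_set hne]
    · exact fun k _ => ⟨(add_pos_of_nonneg_of_pos (normSqE_nonneg E _) hε).le,
        dyad_mem_smul_convexHull (ha k) hε⟩
  simpa only [Prod.fst_sum, Prod.snd_sum] using key.2

lemma zero_mem_dict {Φ Ψ : Herm (Fin 2)} (hC : IsOneDimensional Φ Ψ) (F G : Matrix p n ℂ) :
    0 ∈ dict Φ Ψ F G := by
  obtain ⟨x, hx, -⟩ := hC
  exact ⟨x, hx, Matrix.mulVec_zero _⟩

/-- The gauge of a feasible matrix `X` is `tr (E X Eᴴ)`. -/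
theorem symGauge_eq {Φ Ψ : Herm (Fin 2)}
    (hΦ : (Φ : Matrix (Fin 2) (Fin 2) ℂ).det.re < 0) (hC : IsOneDimensional Φ Ψ)
    {F G : Matrix p n ℂ} (E : Matrix q n ℂ) {X : Herm n} (hX : PrimalFeasible Φ Ψ F G X) :
    symGauge Φ Ψ F G E X = (trInner X (gram E) : ℝ) := by
  apply le_antisymm
  · obtain ⟨r, a, ha, rfl⟩ := exists_dict_decomposition hΦ hC hX
    simp only [trInner_sum_dyad, herForm_gram]
    refine EReal.le_of_forall_lt_iff_le.1 fun z hz => ?_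
    rw [EReal.coe_lt_coe_iff] at hz
    -- The gap is shared among `r` terms; the denominator `r + 1` also covers `r = 0`.
    have hε : 0 < (z - ∑ k, normSqE E (a k)) / (r + 1) := by
      have := sub_pos.2 hz
      positivity
    obtain ⟨y, hy, hXy⟩ := sum_dyad_mem_smul_convexHull (E := E) (zero_mem_dict hC F G) ha hε
    refine (iInf₂_le _ ⟨Finset.sum_nonneg fun k _ =>
      (add_pos_of_nonneg_of_pos (normSqE_nonneg E _) hε).le, y, hy, hXy.symm⟩).trans ?_
    rw [EReal.coe_le_coe_iff, Finset.sum_add_distrib, Finset.sum_const, Finset.card_univ,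
      Fintype.card_fin, nsmul_eq_mul]
    have : (r : ℝ) * ((z - ∑ k, normSqE E (a k)) / (r + 1)) ≤ z - ∑ k, normSqE E (a k) := by
      rw [mul_div_assoc', div_le_iff₀ (by positivity)]
      nlinarith
    linarith
  · refine le_iInf₂ fun t ⟨ht, y, hy, hXy⟩ => ?_
    rw [EReal.coe_le_coe_iff, hXy, trInner_smul_left]
    exact mul_le_of_le_one_right ht (mem_convexHull_atoms hy).2

/-- The gauge of an infeasible matrix is `+∞`. -/
theorem symGauge_eq_top {Φ Ψ : Herm (Fin 2)} {F G : Matrix p n ℂ} (E : Matrix q n ℂ) {X : Herm n}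
    (hX : ¬ PrimalFeasible Φ Ψ F G X) : symGauge Φ Ψ F G E X = ⊤ := by
  refine iInf₂_eq_top.2 fun t ⟨ht, y, hy, hXy⟩ => (hX ?_).elim
  rw [hXy]
  exact (mem_convexHull_atoms hy).1.smul ht

end gauge

/-! ### Kernels of the pencil span the space; a strictly feasible matrix. -/

section slater

set_option linter.unusedSectionVars false

variable {p n q : Type*} [Fintype p] [Fintype n] [Fintype q]

lemma FullRowRank.surjective {F G : Matrix p n ℂ} (h : FullRowRank F G) {μ ν : ℂ}
    (hx : (μ, ν) ≠ (0, 0)) : Function.Surjective (μ • G - ν • F).mulVecLin := by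
  rw [← LinearMap.range_eq_top]
  apply Submodule.eq_top_of_finrank_eq
  rw [Module.finrank_fintype_fun_eq_card]
  exact h μ ν hx

/-- The kernels of a pencil of full row rank at infinitely many points span the whole space. -/
lemma FullRowRank.span_kernels {F G : Matrix p n ℂ} (h : FullRowRank F G) (x : ℕ → ℂ × ℂ)
    (hx0 : ∀ i, x i ≠ 0) (hx : ∀ i j, i ≠ j → (x i).1 * (x j).2 - (x i).2 * (x j).1 ≠ 0) :
    Submodule.span ℂ {a : n → ℂ | ∃ i, ((x i).1 • G - (x i).2 • F) *ᵥ a = 0} = ⊤ := by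
  let L : ℂ × ℂ → (n → ℂ) →ₗ[ℂ] (p → ℂ) := fun y => (y.1 • G - y.2 • F).mulVecLin
  let K : ℕ → Submodule ℂ (n → ℂ) := fun i => LinearMap.ker (L (x i))
  have hL : ∀ y a, L y a = y.1 • G *ᵥ a - y.2 • F *ᵥ a := fun y a => by
    simp [L]
  obtain ⟨m, hm⟩ := monotone_stabilizes_iff_noetherian.2
    (inferInstance : IsNoetherian ℂ (n → ℂ)) (partialSups K)
  set V : Submodule ℂ (n → ℂ) := partialSups K m with hV
  -- A further point, whose kernel already lies in the stabilized sum `V`, while the kernels at the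
  -- points up to `m` generate `V`.
  let y := x (m + 1)
  have hKV : LinearMap.ker (L y) ≤ V := by
    rw [hm (m + 1) (Nat.le_succ m)]
    exact le_partialSups K (m + 1)
  have hVspan : V ≤ Submodule.span ℂ {a | ∃ i, ((x i).1 • G - (x i).2 • F) *ᵥ a = 0} :=
    partialSups_le _ _ _ fun i _ a ha => Submodule.subset_span ⟨i, ha⟩
  rw [eq_top_iff]
  refine le_trans (not_lt_top_iff.1 fun hlt => ?_).ge hVspan
  -- On a kernel vector at `x i`, all values of the pencil are multiples of one `s`, and the value
  -- at `y` is a nonzero multiple of it. So the whole pencil descends to the quotients.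
  have hmap : ∀ z, V ≤ (V.map (L y)).comap (L z) := by
    refine fun z => partialSups_le _ _ _ fun i hi a ha => ?_
    have haV : a ∈ V := le_partialSups_of_le K hi ha
    obtain ⟨s, hF, hG⟩ := exists_direction (hx0 i) (F := F) (G := G) ha
    have hδ := hx (m + 1) i (by omega)
    refine ⟨((y.1 * (x i).2 - y.2 * (x i).1)⁻¹ * (z.1 * (x i).2 - z.2 * (x i).1)) • a,
      V.smul_mem _ haV, ?_⟩
    rw [map_smul, hL, hL, hF, hG]
    simp only [smul_smul, ← sub_smul, mul_assoc]
    congr 1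
    rw [mul_comm, mul_assoc, mul_inv_cancel₀ hδ, mul_one]
  let Q : ℂ × ℂ → ((n → ℂ) ⧸ V) →ₗ[ℂ] ((p → ℂ) ⧸ V.map (L y)) := fun z =>
    Submodule.mapQ V (V.map (L y)) (L z) (hmap z)
  have hsurj : ∀ z ≠ 0, Function.Surjective (Q z) := by
    intro z hz u
    obtain ⟨u, rfl⟩ := Submodule.Quotient.mk_surjective _ u
    obtain ⟨a, rfl⟩ := h.surjective (μ := z.1) (ν := z.2) hz u
    exact ⟨Submodule.Quotient.mk a, rfl⟩
  have hinj : Function.Injective (Q y) := by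
    rw [← LinearMap.ker_eq_bot, LinearMap.ker_eq_bot']
    intro u hu
    obtain ⟨a, rfl⟩ := Submodule.Quotient.mk_surjective _ u
    obtain ⟨b, hb, hab⟩ := (Submodule.Quotient.mk_eq_zero _).1 hu
    rw [Submodule.Quotient.mk_eq_zero]
    have : a - b ∈ LinearMap.ker (L y) := by rw [LinearMap.mem_ker, map_sub, hab, sub_self]
    simpa using V.add_mem (hKV this) hb
  let e := LinearEquiv.ofBijective (Q y) ⟨hinj, hsurj y (hx0 _)⟩
  have : Nontrivial ((n → ℂ) ⧸ V) := Submodule.Quotient.nontrivial_iff.2 hlt.ne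
  -- Orthogonal to `y`, so `z - τ • y` is nonzero for every `τ`. An eigenvalue `τ` of `(Q y)⁻¹ Q z`
  -- then contradicts surjectivity of the square pencil at `z - τ • y`.
  let z : ℂ × ℂ := (-star y.2, star y.1)
  obtain ⟨τ, hτ⟩ := Module.End.exists_eigenvalue (e.symm.toLinearMap ∘ₗ Q z)
  obtain ⟨u, hu⟩ := hτ.exists_hasEigenvector
  have h1 : Q z u = τ • Q y u := by
    have := congrArg e hu.apply_eq_smul
    rwa [LinearMap.comp_apply, LinearEquiv.coe_coe, LinearEquiv.apply_symm_apply, map_smul] at this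
  have h2 : Q (z - τ • y) u = 0 := by
    have h3 : ∀ w, Q (z - τ • y) w = Q z w - τ • Q y w := by
      intro w
      obtain ⟨a, rfl⟩ := Submodule.Quotient.mk_surjective _ w
      have : L (z - τ • y) a = L z a - τ • L y a := by
        simp only [hL, Prod.fst_sub, Prod.snd_sub, Prod.smul_fst, Prod.smul_snd]
        module
      exact congrArg Submodule.Quotient.mk this
    rw [h3, h1, sub_self]
  have hzy : z - τ • y ≠ 0 := by
    intro h0
    rw [sub_eq_zero, Prod.ext_iff] at h0
    obtain ⟨h4, h5⟩ := h0
    simp only [z, Prod.smul_fst, Prod.smul_snd, smul_eq_mul, Complex.star_def] at h4 h5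
    have h6 : Complex.normSq y.1 + Complex.normSq y.2 = 0 := by
      apply Complex.ofReal_injective
      push_cast
      rw [Complex.normSq_eq_conj_mul_self, Complex.normSq_eq_conj_mul_self]
      linear_combination y.1 * h5 - y.2 * h4
    have h7 := Complex.normSq_nonneg y.1
    have h8 := Complex.normSq_nonneg y.2
    exact hx0 (m + 1) (Prod.ext (Complex.normSq_eq_zero.1 (by linarith))
      (Complex.normSq_eq_zero.1 (by linarith)))
  have h9 : Function.Injective (e.symm.toLinearMap ∘ₗ Q (z - τ • y)) :=
    LinearMap.injective_iff_surjective.2 (e.symm.surjective.comp (hsurj _ hzy))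
  refine hu.2 (h9 ?_)
  rw [map_zero, LinearMap.comp_apply, h2, map_zero]

/-- A strictly feasible point. -/
lemma exists_strictly_feasible {Φ Ψ : Herm (Fin 2)} {F G : Matrix p n ℂ} (h : FullRowRank F G)
    (x : ℕ → ℂ × ℂ) (hx0 : ∀ i, x i ≠ 0)
    (hx : ∀ i j, i ≠ j → (x i).1 * (x j).2 - (x i).2 * (x j).1 ≠ 0)
    (hxΦ : ∀ i, quadForm Φ (x i).1 (x i).2 = 0) (hxΨ : ∀ i, quadForm Ψ (x i).1 (x i).2 < 0) :
    ∃ X : Herm n, (∀ a ≠ 0, 0 < herForm X a) ∧ pencilHerm Φ F G X = 0 ∧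
      ∀ b ≠ 0, herForm (pencilHerm Ψ F G X) b < 0 := by
  obtain ⟨s, hs, hspan⟩ := Submodule.fg_span_iff_fg_span_finset_subset _ |>.1
    (IsNoetherian.noetherian (Submodule.span ℂ
      {a : n → ℂ | ∃ i, ((x i).1 • G - (x i).2 • F) *ᵥ a = 0}))
  rw [h.span_kernels x hx0 hx] at hspan
  have hs' : ∀ a ∈ s, ∃ i v, F *ᵥ a = (x i).1 • v ∧ G *ᵥ a = (x i).2 • v := fun a ha => by
    obtain ⟨i, hi⟩ := hs ha
    exact ⟨i, exists_direction (hx0 i) hi⟩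
  choose! i v hF hG using hs'
  have hsΨ : ∀ b, ∀ a ∈ s, herForm (pencilHerm Ψ F G (dyad a)) b ≤ 0 := fun b a ha => by
    rw [pencilHerm_dyad Ψ (hF a ha) (hG a ha), herForm_smul, herForm_dyad]
    exact mul_nonpos_of_nonpos_of_nonneg (hxΨ _).le (sq_nonneg _)
  have hzero : ∀ l : (n → ℂ) →ₗ[ℂ] ℂ, (∀ a ∈ s, l a = 0) → l = 0 := fun l hl =>
    LinearMap.ext_on hspan.symm fun a ha => hl a ha
  have hflip : ∀ a b : n → ℂ, star a ⬝ᵥ b = 0 → star b ⬝ᵥ a = 0 := by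
    intro a b hab
    rw [Matrix.star_dotProduct, hab, star_zero]
  have hflip' : ∀ a b : p → ℂ, star a ⬝ᵥ b = 0 → star b ⬝ᵥ a = 0 := by
    intro a b hab
    rw [Matrix.star_dotProduct, hab, star_zero]
  refine ⟨∑ a ∈ s, dyad a, fun b hb => ?_, ?_, fun b hb => ?_⟩
  · rw [herForm_sum]
    simp only [herForm_dyad]
    refine lt_of_le_of_ne (Finset.sum_nonneg fun _ _ => sq_nonneg _) fun h0 => hb ?_
    rw [eq_comm, Finset.sum_eq_zero_iff_of_nonneg fun _ _ => sq_nonneg _] at h0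
    have := hzero (dotProductBilin ℂ ℂ (star b)) fun a ha =>
      hflip _ _ (by simpa using h0 a ha)
    exact dotProduct_star_self_eq_zero.1 (LinearMap.congr_fun this b)
  · rw [map_sum]
    refine Finset.sum_eq_zero fun a ha => ?_
    rw [pencilHerm_dyad Φ (hF a ha) (hG a ha), hxΦ, zero_smul]
  · rw [map_sum, herForm_sum]
    refine lt_of_le_of_ne (Finset.sum_nonpos (hsΨ b)) fun h0 => hb ?_
    rw [Finset.sum_eq_zero_iff_of_nonpos (hsΨ b)] at h0
    -- If the form vanishes at `b`, then `b` is orthogonal to every `v a`, so `bᴴ F` vanishes on a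
    -- spanning set; `F`, the pencil at `(0, -1)`, is surjective.
    have := hzero (dotProductBilin ℂ ℂ (star b) ∘ₗ F.mulVecLin) fun a ha => ?_
    · obtain ⟨a, ha⟩ := h.surjective (μ := 0) (ν := -1) (by simp) b
      have hab := LinearMap.congr_fun this a
      simp only [zero_smul, zero_sub, neg_smul, one_smul, neg_neg] at ha
      rw [LinearMap.comp_apply, ha] at hab
      exact dotProduct_star_self_eq_zero.1 hab
    · have h1 := h0 a ha
      rw [pencilHerm_dyad Ψ (hF a ha) (hG a ha), herForm_smul, herForm_dyad, mul_eq_zero,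
        or_iff_right (hxΨ _).ne, sq_eq_zero_iff, norm_eq_zero] at h1
      have h2 := hflip' _ _ h1
      rw [LinearMap.comp_apply, Matrix.mulVecLin_apply, hF a ha, map_smul]
      exact smul_eq_zero_of_right _ h2

end slater

/-! ### Conic duality and the linear matrix inequality. -/

section duality

set_option linter.unusedSectionVars false

variable {p n q : Type*} [Fintype p] [Fintype n] [Fintype q]

lemma continuous_herForm (Z : Herm n) : Continuous (herForm Z) := by
  unfold herForm
  fun_prop

/-- A positive definite matrix is an order unit. -/
lemma exists_smul_add_nonneg {X : Herm n} (hX : ∀ a ≠ 0, 0 < herForm X a) (Y : Herm n) :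
    ∃ t : ℝ, ∀ s ≥ t, ∀ a, 0 ≤ herForm (s • X + Y) a := by
  -- Any bound for this ratio on the compact sphere serves as `t`, by homogeneity.
  have hcont : ContinuousOn (fun a => -herForm Y a / herForm X a) (Metric.sphere (0 : n → ℂ) 1) :=
    (continuous_herForm Y).neg.continuousOn.div (continuous_herForm X).continuousOn fun a ha =>
      (hX a (ne_zero_of_mem_unit_sphere ⟨a, ha⟩)).ne'
  obtain ⟨t, ht⟩ := (isCompact_sphere (0 : n → ℂ) 1).bddAbove_image hcont
  refine ⟨t, fun s hs a => ?_⟩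
  by_cases ha : a = 0
  · simp [ha, herForm]
  have hn : ‖a‖ ≠ 0 := norm_ne_zero_iff.2 ha
  have hu : ((‖a‖⁻¹ : ℝ) : ℂ) • a ∈ Metric.sphere (0 : n → ℂ) 1 := by
    rw [mem_sphere_zero_iff_norm, norm_smul, Complex.norm_real, norm_inv, norm_norm,
      inv_mul_cancel₀ hn]
  have h1 := ht (Set.mem_image_of_mem _ hu)
  rw [div_le_iff₀ (hX _ (ne_zero_of_mem_unit_sphere ⟨_, hu⟩)), herForm_smul_right,
    herForm_smul_right] at h1
  have h2 : 0 < ‖a‖⁻¹ ^ 2 := by positivity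
  have h3 : -herForm Y a ≤ t * herForm X a := by
    refine le_of_mul_le_mul_left ?_ h2
    linarith
  rw [herForm_add, herForm_smul]
  nlinarith [hX a ha]

/-- The cone of pairs of positive semidefinite matrices. -/
def psdCone (n p : Type*) [Fintype n] [Fintype p] : PointedCone ℝ (Herm n × Herm p) where
  carrier := {w | (∀ a, 0 ≤ herForm w.1 a) ∧ ∀ b, 0 ≤ herForm w.2 b}
  add_mem' := fun ⟨h1, h2⟩ ⟨h3, h4⟩ =>
    ⟨fun a => by rw [Prod.fst_add, herForm_add]; exact add_nonneg (h1 a) (h3 a),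
      fun b => by rw [Prod.snd_add, herForm_add]; exact add_nonneg (h2 b) (h4 b)⟩
  zero_mem' := by simp
  smul_mem' := fun c w ⟨h1, h2⟩ =>
    ⟨fun a => (mul_nonneg c.2 (h1 a)).trans_eq (herForm_smul c.1 w.1 a).symm,
      fun b => (mul_nonneg c.2 (h2 b)).trans_eq (herForm_smul c.1 w.2 b).symm⟩

/-- Strong duality under strict feasibility. -/
lemma exists_multipliers {Φ Ψ : Herm (Fin 2)} {F G : Matrix p n ℂ} {W : Herm n}
    (hW : ∀ X, PrimalFeasible Φ Ψ F G X → 0 ≤ trInner X W) {X₀ : Herm n}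
    (h₀ : ∀ a ≠ 0, 0 < herForm X₀ a) (h₀Φ : pencilHerm Φ F G X₀ = 0)
    (h₀Ψ : ∀ b ≠ 0, herForm (pencilHerm Ψ F G X₀) b < 0) :
    ∃ P Q : Herm p, (∀ b, 0 ≤ herForm Q b) ∧ ∀ X : Herm n, (∀ a, 0 ≤ herForm X a) →
      0 ≤ trInner X W + trInner P (pencilHerm Φ F G X) + trInner Q (pencilHerm Ψ F G X) := by
  let j : Herm n →ₗ[ℝ] Herm n × Herm p := LinearMap.prod LinearMap.id (-pencilHerm Ψ F G)
  -- The functional `tr (X W)` on the pairs `(X, -Ψ(X))` with `Φ(X) = 0` is nonnegative on the psd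
  -- cone. Strict feasibility is what allows a positive extension to all pairs; its second component
  -- is `Q`.
  let f : (Herm n × Herm p) →ₗ.[ℝ] ℝ :=
    ⟨(LinearMap.ker (pencilHerm Φ F G)).map j,
      (trForm.flip W ∘ₗ LinearMap.fst ℝ (Herm n) (Herm p)).domRestrict _⟩
  have hf : ∀ w : f.domain, (w : Herm n × Herm p) ∈ psdCone n p → 0 ≤ f w := by
    rintro ⟨_, X, hX, rfl⟩ ⟨h1, h2⟩
    refine hW X ((primalFeasible_iff _ _ _ _ _).2 ⟨h1, hX, fun b => ?_⟩)
    simpa [j] using h2 b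
  have hext : ∀ w : Herm n × Herm p, ∃ x : f.domain, (x : Herm n × Herm p) + w ∈ psdCone n p := by
    rintro ⟨Y, N⟩
    have h₀N : ∀ b ≠ 0, 0 < herForm (-pencilHerm Ψ F G X₀) b := fun b hb => by
      rw [herForm_neg]; linarith [h₀Ψ b hb]
    obtain ⟨t, ht⟩ := exists_smul_add_nonneg h₀ Y
    obtain ⟨u, hu⟩ := exists_smul_add_nonneg h₀N N
    refine ⟨⟨j (max t u • X₀), _, ?_, rfl⟩, ht _ (le_max_left t u), ?_⟩
    · simp [h₀Φ]
    · simpa [j] using hu _ (le_max_right t u)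
  obtain ⟨g, hgf, hg⟩ := riesz_extension (psdCone n p) f hf hext
  obtain ⟨Q, hQ⟩ := exists_trInner_eq (g ∘ₗ LinearMap.inr ℝ (Herm n) (Herm p))
  let l : Herm n →ₗ[ℝ] ℝ := g ∘ₗ LinearMap.inl ℝ (Herm n) (Herm p) -
    (trForm Q) ∘ₗ pencilHerm Ψ F G - trForm.flip W
  -- The remainder vanishes on the kernel of the pencil map of `Φ`, hence factors through that map;
  -- the factor is `P`.
  have hl : l ∈ LinearMap.range (pencilHerm Φ F G).dualMap := by
    rw [LinearMap.range_dualMap_eq_dualAnnihilator_ker, Submodule.mem_dualAnnihilator]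
    intro X hX
    have h1 : g (j X) = trInner X W := hgf ⟨j X, X, hX, rfl⟩
    have h2 : j X = LinearMap.inl ℝ (Herm n) (Herm p) X +
        LinearMap.inr ℝ (Herm n) (Herm p) (-pencilHerm Ψ F G X) := by simp [j]
    have h3 := hQ (-pencilHerm Ψ F G X)
    simp only [LinearMap.comp_apply] at h3
    rw [h2, map_add, h3, trInner_neg_right] at h1
    simp only [l, LinearMap.sub_apply, LinearMap.comp_apply, trForm_apply, LinearMap.flip_apply]
    linarith
  obtain ⟨k, hk⟩ := hl
  obtain ⟨P, hP⟩ := exists_trInner_eq k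
  refine ⟨P, Q, fun b => ?_, fun X hX => ?_⟩
  · rw [← trInner_dyad, trInner_comm, ← hQ]
    exact hg _ ⟨by simp, by simpa using (posSemidef_iff_herForm _).1 (dyad_posSemidef b)⟩
  · have h1 := LinearMap.congr_fun hk X
    rw [LinearMap.dualMap_apply, hP] at h1
    simp only [l, LinearMap.sub_apply, LinearMap.comp_apply, trForm_apply,
      LinearMap.flip_apply] at h1
    have h2 : 0 ≤ g (LinearMap.inl ℝ (Herm n) (Herm p) X) :=
      hg _ ⟨by simpa using hX, by simp⟩
    linarith

/-- The matrix `[F; G]ᴴ (Θ ⊗ P) [F; G]`. -/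
def stackHerm (Θ : Herm (Fin 2)) (F G : Matrix p n ℂ) (P : Herm p) : Herm n :=
  ⟨(stack F G)ᴴ * ((Θ : Matrix (Fin 2) (Fin 2) ℂ) ⊗ₖ (P : Matrix p p ℂ)) * stack F G, by
    refine Matrix.isHermitian_conjTranspose_mul_mul _ ?_
    rw [Matrix.IsHermitian, Matrix.conjTranspose_kronecker, Θ.isHermitian.eq, P.isHermitian.eq]⟩

lemma herForm_stackHerm (Θ : Herm (Fin 2)) (F G : Matrix p n ℂ) (P : Herm p) (a : n → ℂ) :
    herForm (stackHerm Θ F G P) a = trInner P (pencilHerm Θ F G (dyad a)) := by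
  rw [← trInner_dyad, ← trInner_stack]
  rfl

lemma isCertificate_iff (Φ Ψ : Herm (Fin 2)) (F G : Matrix p n ℂ) (E : Matrix q n ℂ)
    (Z : Herm n) (P Q : Herm p) :
    IsCertificate Φ Ψ F G E Z P Q ↔ (∀ b, 0 ≤ herForm Q b) ∧
      ∀ a, 0 ≤ normSqE E a - herForm Z a + trInner P (pencilHerm Φ F G (dyad a)) +
        trInner Q (pencilHerm Ψ F G (dyad a)) := by
  have h := posSemidef_iff_herForm (gram E - (Z - (stackHerm Φ F G P + stackHerm Ψ F G Q)))
  rw [IsCertificate, posSemidef_iff_herForm, Matrix.mul_add, Matrix.add_mul]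
  refine and_congr_right' (h.trans (forall_congr' fun a => ?_))
  simp only [herForm_sub, herForm_add, herForm_stackHerm, herForm_gram]
  rw [← sub_add, ← add_assoc]

/-- Weak duality: on `a ∈ 𝒜` the term with `P` vanishes and the term with `Q` is `q_Ψ(μ, ν) sᴴ Q s ≤
0`. -/
lemma LMIFeasible.boundedOnDict {Φ Ψ : Herm (Fin 2)} {F G : Matrix p n ℂ} {E : Matrix q n ℂ}
    {Z : Herm n} (h : LMIFeasible Φ Ψ F G E Z) : BoundedOnDict Φ Ψ F G E Z := by
  obtain ⟨P, Q, hPQ⟩ := h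
  rw [isCertificate_iff] at hPQ
  rintro a ⟨x, ⟨hx0, hxΦ, hxΨ⟩, hxa⟩
  obtain ⟨s, hF, hG⟩ := exists_direction hx0 hxa
  have h1 := hPQ.2 a
  rw [pencilHerm_dyad Φ hF hG, pencilHerm_dyad Ψ hF hG, hxΦ, zero_smul, trInner_comm Q,
    trInner_smul_left, trInner_dyad] at h1
  have h2 := mul_nonpos_of_nonpos_of_nonneg hxΨ (hPQ.1 s)
  have h3 : trInner P 0 = 0 := by simp [trInner]
  linarith

lemma BoundedOnDict.trInner_le {Φ Ψ : Herm (Fin 2)}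
    (hΦ : (Φ : Matrix (Fin 2) (Fin 2) ℂ).det.re < 0) (hC : IsOneDimensional Φ Ψ)
    {F G : Matrix p n ℂ} {E : Matrix q n ℂ} {Z X : Herm n} (hZ : BoundedOnDict Φ Ψ F G E Z)
    (hX : PrimalFeasible Φ Ψ F G X) : trInner X Z ≤ trInner X (gram E) := by
  obtain ⟨r, a, ha, rfl⟩ := exists_dict_decomposition hΦ hC hX
  rw [trInner_sum_dyad, trInner_sum_dyad]
  refine Finset.sum_le_sum fun k _ => ?_
  rw [herForm_gram]
  exact hZ _ (ha k)

lemma trInner_sub_right (X Y Z : Herm n) : trInner X (Y - Z) = trInner X Y - trInner X Z := by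
  simp [trInner, mul_sub]

/-- The duality theorem for a curve with infinitely many points at which `q_Ψ` is negative. -/
lemma BoundedOnDict.lmiFeasible_of_points {Φ Ψ : Herm (Fin 2)}
    (hΦ : (Φ : Matrix (Fin 2) (Fin 2) ℂ).det.re < 0) (hC : IsOneDimensional Φ Ψ)
    {F G : Matrix p n ℂ} (h : FullRowRank F G) {E : Matrix q n ℂ} {Z : Herm n}
    (x : ℕ → ℂ × ℂ) (hx0 : ∀ i, x i ≠ 0)
    (hx : ∀ i j, i ≠ j → (x i).1 * (x j).2 - (x i).2 * (x j).1 ≠ 0)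
    (hxΦ : ∀ i, quadForm Φ (x i).1 (x i).2 = 0) (hxΨ : ∀ i, quadForm Ψ (x i).1 (x i).2 < 0)
    (hZ : BoundedOnDict Φ Ψ F G E Z) : LMIFeasible Φ Ψ F G E Z := by
  obtain ⟨X₀, h₀, h₀Φ, h₀Ψ⟩ := exists_strictly_feasible h x hx0 hx hxΦ hxΨ
  obtain ⟨P, Q, hQ, hPQ⟩ := exists_multipliers (W := gram E - Z) (fun X hX => by
    rw [trInner_sub_right]
    linarith [hZ.trInner_le hΦ hC hX]) h₀ h₀Φ h₀Ψ
  refine ⟨P, Q, (isCertificate_iff _ _ _ _ _ _ _ _).2 ⟨hQ, fun a => ?_⟩⟩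
  have := hPQ (dyad a) ((posSemidef_iff_herForm _).1 (dyad_posSemidef a))
  rwa [trInner_dyad, herForm_sub, herForm_gram] at this

lemma quadForm_neg_one_neg {μ ν : ℂ} (h : (μ, ν) ≠ (0 : ℂ × ℂ)) :
    quadForm (-1) μ ν < 0 := by
  rw [quadForm_eq_re]
  simp
  by_contra! hle
  refine h (Prod.ext (Complex.normSq_eq_zero.1 ?_) (Complex.normSq_eq_zero.1 ?_)) <;>
  linarith [Complex.normSq_nonneg μ, Complex.normSq_nonneg ν]

lemma trInner_pencilHerm_neg_one_nonpos {Q : Herm p} (hQ : ∀ b, 0 ≤ herForm Q b)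
    (F G : Matrix p n ℂ) (a : n → ℂ) : trInner Q (pencilHerm (-1) F G (dyad a)) ≤ 0 := by
  have : pencilHerm (-1) F G (dyad a) = -(dyad (F *ᵥ a) + dyad (G *ᵥ a)) := by
    apply Subtype.ext
    rw [coe_pencilHerm, pencilMap]
    simp only [mul_dyad_mul]
    simp
    abel
  rw [this, trInner_neg_right, trInner_comm, trInner_add_left, trInner_dyad, trInner_dyad]
  linarith [hQ (F *ᵥ a), hQ (G *ᵥ a)]

lemma trInner_zero_left (X : Herm n) : trInner 0 X = 0 := by simp [trInner]

lemma curve_eq_of_redundant {Φ Ψ : Herm (Fin 2)}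
    (hR : ∀ μ ν, quadForm Φ μ ν = 0 → quadForm Ψ μ ν ≤ 0) : curve Φ Ψ = curve Φ 0 := by
  ext y
  refine and_congr_right fun _ => and_congr_right fun hyΦ => iff_of_true (hR _ _ hyΦ) ?_
  simp [quadForm]

/-- The linear matrix inequality is feasible exactly for the matrices bounded on `𝒜`. -/
theorem lmiFeasible_iff_boundedOnDict {Φ Ψ : Herm (Fin 2)}
    (hΦ : (Φ : Matrix (Fin 2) (Fin 2) ℂ).det.re < 0) (hC : IsOneDimensional Φ Ψ)
    {F G : Matrix p n ℂ} (h : FullRowRank F G) (E : Matrix q n ℂ) (Z : Herm n) :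
    LMIFeasible Φ Ψ F G E Z ↔ BoundedOnDict Φ Ψ F G E Z := by
  refine ⟨LMIFeasible.boundedOnDict, fun hZ => ?_⟩
  obtain ⟨T, c, hT, hc, hΦT, hΨT⟩ := exists_normalForm hΦ hC
  -- The images of the real parameters `1, 2, 3, …`. Starting at `1` excludes the endpoint of the
  -- half-line, where `q_Ψ` is zero.
  let x : ℕ → ℂ × ℂ := fun i => (T 0 0 * (i + 1 : ℝ) + T 0 1 * 1, T 1 0 * (i + 1 : ℝ) + T 1 1 * 1)
  have hx : ∀ i j, i ≠ j → (x i).1 * (x j).2 - (x i).2 * (x j).1 ≠ 0 := by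
    intro i j hij
    have : (x i).1 * (x j).2 - (x i).2 * (x j).1 = T.det * ((i : ℂ) - j) := by
      rw [Matrix.det_fin_two]
      simp only [x]
      push_cast
      ring
    rw [this]
    exact mul_ne_zero hT (sub_ne_zero.2 (by exact_mod_cast hij))
  have hx0 : ∀ i, x i ≠ 0 := by
    intro i h0
    refine hx i (i + 1) (by omega) ?_
    rw [h0]
    simp
  have hxΦ : ∀ i, quadForm Φ (x i).1 (x i).2 = 0 := by
    intro i
    simp only [x]
    rw [← quadForm_congruence, hΦT.quadForm]
    simp
  rcases hΨT with hR | ⟨z, hz0, hz⟩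
  · have hcurve : curve Φ Ψ = curve Φ (-1) := by
      ext y
      refine and_congr_right fun hy0 => and_congr_right fun hyΦ => ?_
      exact iff_of_true (hR _ _ hyΦ) (quadForm_neg_one_neg hy0).le
    have hC' : IsOneDimensional Φ (-1) := by rwa [IsOneDimensional, ← hcurve]
    have hZ' : BoundedOnDict Φ (-1) F G E Z := by rwa [BoundedOnDict, dict, ← hcurve]
    obtain ⟨P, Q, hPQ⟩ := hZ'.lmiFeasible_of_points hΦ hC' h x hx0 hx hxΦ
      fun i => quadForm_neg_one_neg (hx0 i)
    rw [isCertificate_iff] at hPQ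
    refine ⟨P, 0, (isCertificate_iff _ _ _ _ _ _ _ _).2 ⟨by simp, fun a => ?_⟩⟩
    rw [trInner_zero_left]
    linarith [hPQ.2 a, trInner_pencilHerm_neg_one_nonpos hPQ.1 F G a]
  · refine hZ.lmiFeasible_of_points hΦ hC h x hx0 hx hxΦ fun i => ?_
    simp only [x]
    rw [← quadForm_congruence, hz.quadForm]
    simp
    have : (0 : ℝ) < i + 1 := by positivity
    nlinarith

end duality

/-! ### The conjugate of the gauge, the dual problem and complementary slackness. -/

section conjugate

set_option linter.unusedSectionVars false

variable {p n q : Type*} [Fintype p] [Fintype n] [Fintype q]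

lemma BoundedOnDict.conjugate_eq_zero {Φ Ψ : Herm (Fin 2)}
    (hΦ : (Φ : Matrix (Fin 2) (Fin 2) ℂ).det.re < 0) (hC : IsOneDimensional Φ Ψ)
    {F G : Matrix p n ℂ} {E : Matrix q n ℂ} {Z : Herm n} (hZ : BoundedOnDict Φ Ψ F G E Z) :
    conjugate (symGauge Φ Ψ F G E) Z = 0 := by
  apply le_antisymm
  · refine iSup_le fun X => ?_
    by_cases hX : PrimalFeasible Φ Ψ F G X
    · rw [symGauge_eq hΦ hC E hX, ← EReal.coe_sub]
      exact_mod_cast sub_nonpos.2 (hZ.trInner_le hΦ hC hX)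
    · rw [symGauge_eq_top E hX, EReal.sub_top]
      exact bot_le
  · refine le_iSup_of_le 0 ?_
    rw [symGauge_eq hΦ hC E (PrimalFeasible.zero Φ Ψ F G)]
    simp [trInner_zero_left]

lemma conjugate_eq_top {Φ Ψ : Herm (Fin 2)}
    (hΦ : (Φ : Matrix (Fin 2) (Fin 2) ℂ).det.re < 0) (hC : IsOneDimensional Φ Ψ)
    {F G : Matrix p n ℂ} {E : Matrix q n ℂ} {Z : Herm n} (hZ : ¬ BoundedOnDict Φ Ψ F G E Z) :
    conjugate (symGauge Φ Ψ F G E) Z = ⊤ := by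
  obtain ⟨a, ha, hlt⟩ : ∃ a ∈ dict Φ Ψ F G, normSqE E a < herForm Z a := by
    simpa [BoundedOnDict] using hZ
  rw [EReal.eq_top_iff_forall_lt]
  intro y
  have hδ : 0 < herForm Z a - normSqE E a := sub_pos.2 hlt
  -- Along the feasible ray `t a aᴴ` the objective is `t` times the violation; this `t` makes it
  -- `|y| + 1`.
  have ht : 0 ≤ (|y| + 1) / (herForm Z a - normSqE E a) := by positivity
  refine lt_of_lt_of_le ?_ (le_iSup _ (((|y| + 1) / (herForm Z a - normSqE E a)) • dyad a))
  rw [symGauge_eq hΦ hC E ((PrimalFeasible.dyad ha).smul ht), ← EReal.coe_sub,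
    EReal.coe_lt_coe_iff, trInner_smul_left, trInner_smul_left, trInner_dyad, trInner_dyad,
    herForm_gram, ← mul_sub, div_mul_cancel₀ _ hδ.ne']
  linarith [le_abs_self y]

lemma dualFeasible_iff (Φ Ψ : Herm (Fin 2)) (F G : Matrix p n ℂ) (E : Matrix q n ℂ)
    (Z : Herm n) : DualFeasible Φ Ψ F G E Z ↔ BoundedOnDict Φ Ψ F G E (-Z) := by
  refine forall₂_congr fun a _ => ?_
  rw [herForm_neg]
  constructor <;> intro h <;> linarith

lemma dualValue_eq {Φ Ψ : Herm (Fin 2)}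
    (hΦ : (Φ : Matrix (Fin 2) (Fin 2) ℂ).det.re < 0) (hC : IsOneDimensional Φ Ψ)
    (F G : Matrix p n ℂ) (E : Matrix q n ℂ) (f : Herm n → ℝ) :
    dualValue Φ Ψ F G E f = ⨆ (Z : Herm n) (_ : DualFeasible Φ Ψ F G E Z), dualObj f Z := by
  refine iSup_congr fun Z => ?_
  by_cases hZ : DualFeasible Φ Ψ F G E Z
  · rw [((dualFeasible_iff Φ Ψ F G E Z).1 hZ).conjugate_eq_zero hΦ hC, sub_zero, iSup_pos hZ]
  · rw [conjugate_eq_top hΦ hC (mt (dualFeasible_iff Φ Ψ F G E Z).2 hZ), EReal.sub_top,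
      iSup_neg hZ]

lemma primalValue_eq {Φ Ψ : Herm (Fin 2)}
    (hΦ : (Φ : Matrix (Fin 2) (Fin 2) ℂ).det.re < 0) (hC : IsOneDimensional Φ Ψ)
    (F G : Matrix p n ℂ) (E : Matrix q n ℂ) (f : Herm n → ℝ) :
    primalValue Φ Ψ F G E f = ⨅ X : Herm n, ((f X : EReal) + symGauge Φ Ψ F G E X) := by
  have key : ∀ {r : ℕ} {a : Fin r → n → ℂ}, (∀ k, a k ∈ dict Φ Ψ F G) →
      (f (∑ k, dyad (a k)) : EReal) + symGauge Φ Ψ F G E (∑ k, dyad (a k)) =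
        primalObj E f a := by
    intro r a ha
    rw [symGauge_eq hΦ hC E (PrimalFeasible.sum_dyad _ ha), primalObj, trInner_sum_dyad]
    simp only [herForm_gram]
    rw [EReal.coe_add]
  apply le_antisymm
  · refine le_iInf fun X => ?_
    by_cases hX : PrimalFeasible Φ Ψ F G X
    · obtain ⟨r, a, ha, rfl⟩ := exists_dict_decomposition hΦ hC hX
      rw [key ha]
      exact iInf_le_of_le r (iInf₂_le a ha)
    · rw [symGauge_eq_top E hX, EReal.coe_add_top]
      exact le_top
  · refine le_iInf fun r => le_iInf₂ fun a ha => ?_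
    rw [← key ha]
    exact iInf_le _ _

lemma dualObj_le (f : Herm n → ℝ) (X Z : Herm n) : dualObj f Z ≤ (f X - trInner X Z : ℝ) := by
  have : ((trInner X Z - f X : ℝ) : EReal) ≤ conjugate (fun X => (f X : EReal)) Z :=
    le_iSup (fun X => ((trInner X Z : ℝ) : EReal) - (f X : EReal)) X
  rw [dualObj, EReal.neg_le, ← EReal.coe_neg, neg_sub]
  exact this

lemma DualFeasible.dualObj_le_primalObj {Φ Ψ : Herm (Fin 2)} {F G : Matrix p n ℂ}
    {E : Matrix q n ℂ} {Z : Herm n} (hZ : DualFeasible Φ Ψ F G E Z) (f : Herm n → ℝ) {r : ℕ}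
    {a : Fin r → n → ℂ} (ha : ∀ k, a k ∈ dict Φ Ψ F G) :
    dualObj f Z ≤ primalObj E f a := by
  refine (dualObj_le f (∑ k, dyad (a k)) Z).trans ?_
  rw [EReal.coe_le_coe_iff, primalObj, trInner_sum_dyad]
  have := Finset.sum_nonneg fun k (_ : k ∈ Finset.univ) => hZ (a k) (ha k)
  rw [Finset.sum_add_distrib] at this
  linarith

/-- Fenchel's inequality bounds the sum of the nonnegative slacks `‖E aₖ‖² + aₖᴴ Z aₖ` above by the
duality gap, which is zero here. -/
lemma complementary_slackness {Φ Ψ : Herm (Fin 2)} {F G : Matrix p n ℂ} {E : Matrix q n ℂ}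
    {Z : Herm n} (hZ : DualFeasible Φ Ψ F G E Z) {f : Herm n → ℝ} {r : ℕ} {a : Fin r → n → ℂ}
    (ha : ∀ k, a k ∈ dict Φ Ψ F G) (h : (primalObj E f a : EReal) = dualObj f Z) :
    (f (∑ k, dyad (a k)) : EReal) + conjugate (fun X => (f X : EReal)) Z =
      ((trInner (∑ k, dyad (a k)) Z : ℝ) : EReal) ∧
    ∀ k, normSqE E (a k) + herForm Z (a k) = 0 := by
  have hnn := fun k (_ : k ∈ Finset.univ) => hZ (a k) (ha k)
  have h1 := dualObj_le f (∑ k, dyad (a k)) Z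
  rw [← h, EReal.coe_le_coe_iff, primalObj, trInner_sum_dyad] at h1
  have h2 : ∑ k, (normSqE E (a k) + herForm Z (a k)) = 0 := by
    refine le_antisymm ?_ (Finset.sum_nonneg hnn)
    rw [Finset.sum_add_distrib]
    linarith
  refine ⟨?_, fun k => (Finset.sum_eq_zero_iff_of_nonneg hnn).1 h2 k (Finset.mem_univ k)⟩
  have h3 : conjugate (fun X => (f X : EReal)) Z = ((-primalObj E f a : ℝ) : EReal) := by
    rw [EReal.coe_neg, h, dualObj, neg_neg]
  rw [Finset.sum_add_distrib] at h2
  rw [h3, ← EReal.coe_add, EReal.coe_eq_coe_iff, primalObj, trInner_sum_dyad]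
  linarith

end conjugate

/-! ### Controllable systems and the frequency-domain inequality. -/

section system

variable {s m : ℕ}

lemma sys_mulVec (A : Matrix (Fin s) (Fin s) ℂ) (B : Matrix (Fin s) (Fin m) ℂ) (μ ν : ℂ)
    (a : Fin s ⊕ Fin m → ℂ) :
    (μ • sysG s m - ν • sysF A B) *ᵥ a =
      (μ • 1 - ν • A) *ᵥ (a ∘ Sum.inl) - ν • B *ᵥ (a ∘ Sum.inr) := by
  rw [Matrix.sub_mulVec, Matrix.sub_mulVec, Matrix.smul_mulVec, Matrix.smul_mulVec,
    Matrix.smul_mulVec, Matrix.smul_mulVec, sysG, sysF, Matrix.fromCols_mulVec,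
    Matrix.fromCols_mulVec, Matrix.zero_mulVec, add_zero, smul_add]
  abel

/-- The Popov-Belevitch-Hautus test. -/
lemma Controllable.fullRowRank {A : Matrix (Fin s) (Fin s) ℂ} {B : Matrix (Fin s) (Fin m) ℂ}
    (h : Controllable A B) : FullRowRank (sysF A B) (sysG s m) := by
  intro μ ν hμν
  -- Full row rank means no nonzero left null vector. For the pencil with `ν ≠ 0`, such a vector
  -- would be a left eigenvector of `A` annihilated by `B`, hence by every `A ^ k * B`.
  have hrank : ∀ {k : Type} [Fintype k] (K : Matrix (Fin s) k ℂ),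
      K.rank = Fintype.card (Fin s) ↔ ∀ w, w ᵥ* K = 0 → w = 0 := by
    intro k _ K
    rw [Matrix.rank_eq_finrank_span_row, eq_comm, ← Set.finrank,
      ← linearIndependent_iff_card_eq_finrank_span, ← Matrix.vecMul_injective_iff]
    exact injective_iff_map_eq_zero K.vecMulLinear
  rw [hrank]
  intro w hw
  have hC := (hrank (Matrix.of fun (i : Fin s) (j : Fin s × Fin m) =>
    (A ^ (j.1 : ℕ) * B) i j.2)).1 (by rw [Fintype.card_fin]; exact h)
  have h1 : μ • w = ν • w ᵥ* A := by
    ext i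
    have := congrFun hw (Sum.inl i)
    rw [Matrix.vecMul_sub, Matrix.vecMul_smul, Matrix.vecMul_smul, sysG, sysF,
      Matrix.vecMul_fromCols, Matrix.vecMul_fromCols] at this
    simpa [sub_eq_zero] using this
  have h2 : ν • w ᵥ* B = 0 := by
    ext i
    have := congrFun hw (Sum.inr i)
    rw [Matrix.vecMul_sub, Matrix.vecMul_smul, Matrix.vecMul_smul, sysG, sysF,
      Matrix.vecMul_fromCols, Matrix.vecMul_fromCols] at this
    simpa [sub_eq_zero] using this
  by_cases hν : ν = 0
  · subst hν
    have hμ : μ ≠ 0 := fun hμ => hμν (by rw [hμ])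
    rw [zero_smul] at h1
    exact (smul_eq_zero_iff_right hμ).1 h1
  · have hB : w ᵥ* B = 0 := (smul_eq_zero_iff_right hν).1 h2
    have hA : w ᵥ* A = (ν⁻¹ * μ) • w := by
      rw [mul_smul, h1, smul_smul, inv_mul_cancel₀ hν, one_smul]
    have hpow : ∀ k : ℕ, w ᵥ* A ^ k = (ν⁻¹ * μ) ^ k • w := by
      intro k
      induction k with
      | zero => simp
      | succ k ih =>
        rw [pow_succ, ← Matrix.vecMul_vecMul, ih, Matrix.smul_vecMul, hA, smul_smul, pow_succ]
    refine hC w (funext fun j => ?_)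
    have : w ᵥ* (A ^ (j.1 : ℕ) * B) = 0 := by
      rw [← Matrix.vecMul_vecMul, hpow, Matrix.smul_vecMul, hB, smul_zero]
    exact congrFun this j.2

lemma coe_gram_add {n q : Type*} [Fintype n] [Fintype q] (E : Matrix q n ℂ) (Z : Herm n) :
    Eᴴ * E + (Z : Matrix n n ℂ) = ((gram E + Z : Herm n) : Matrix n n ℂ) := rfl

lemma popov_posSemidef_iff (A : Matrix (Fin s) (Fin s) ℂ) (B : Matrix (Fin s) (Fin m) ℂ)
    (N : Herm (Fin s ⊕ Fin m)) (z : ℂ) :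
    (popov A B N z).PosSemidef ↔
      ∀ u, 0 ≤ herForm N (Matrix.fromRows ((z • 1 - A)⁻¹ * B) 1 *ᵥ u) := by
  let H := Matrix.fromRows ((z • 1 - A)⁻¹ * B) (1 : Matrix (Fin m) (Fin m) ℂ)
  have hH : (popov A B N z).IsHermitian :=
    Matrix.isHermitian_conjTranspose_mul_mul _ N.isHermitian
  refine (posSemidef_iff_herForm ⟨popov A B N z, hH⟩).trans (forall_congr' fun u => ?_)
  have : herForm ⟨popov A B N z, hH⟩ u = herForm N (H *ᵥ u) := by
    simp only [herForm, popov]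
    rw [← Matrix.mulVec_mulVec, ← Matrix.mulVec_mulVec, Matrix.dotProduct_mulVec,
      Matrix.vecMul_conjTranspose, star_star]
  rw [this]

lemma curve_smul {Φ Ψ : Herm (Fin 2)} {μ ν c : ℂ} (hc : c ≠ 0) (h : (μ, ν) ∈ curve Φ Ψ) :
    (c * μ, c * ν) ∈ curve Φ Ψ := by
  have hq : ∀ Θ, quadForm Θ (c * μ) (c * ν) = Complex.normSq c * quadForm Θ μ ν := by
    intro Θ
    apply Complex.ofReal_injective
    push_cast
    rw [coe_quadForm, coe_quadForm, Complex.normSq_eq_conj_mul_self]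
    simp only [star_mul', Complex.star_def]
    ring
  obtain ⟨h0, hΦ, hΨ⟩ := h
  refine ⟨fun h => h0 ?_, ?_, ?_⟩
  · rw [Prod.ext_iff] at h ⊢
    simpa [hc] using h
  · simp only [hq]
    rw [show quadForm Φ μ ν = 0 from hΦ, mul_zero]
  · simp only [hq]
    exact mul_nonpos_of_nonneg_of_nonpos (Complex.normSq_nonneg c) hΨ

/-- By homogeneity a point of `𝒞` may be taken as `(z, 1)` or `(1, 0)`. In the first case `z I - A`
is invertible and the kernel is parametrized by the input `u`; in the second it consists of the
vectors `(0, u)`. -/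
lemma dualFeasible_iff_popovFeasible {q : Type*} [Fintype q] {Φ Ψ : Herm (Fin 2)}
    {A : Matrix (Fin s) (Fin s) ℂ} (B : Matrix (Fin s) (Fin m) ℂ)
    (E : Matrix q (Fin s ⊕ Fin m) ℂ) (Z : Herm (Fin s ⊕ Fin m))
    (hA : ∀ z : ℂ, (z, 1) ∈ curve Φ Ψ → ¬ Module.End.HasEigenvalue (Matrix.toLin' A) z) :
    DualFeasible Φ Ψ (sysF A B) (sysG s m) E Z ↔ PopovFeasible Φ Ψ A B E Z := by
  have hN : ∀ a, normSqE E a + herForm Z a = herForm (gram E + Z) a := fun a => by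
    rw [herForm_add, herForm_gram]
  have hunit : ∀ z : ℂ, (z, 1) ∈ curve Φ Ψ → IsUnit (z • 1 - A).det := by
    intro z hz
    rw [isUnit_iff_ne_zero]
    intro h0
    obtain ⟨v, hv0, hv⟩ := Matrix.exists_mulVec_eq_zero_iff.2 h0
    refine hA z hz (Module.End.hasEigenvalue_of_hasEigenvector (x := v)
      ⟨Module.End.mem_eigenspace_iff.2 ?_, hv0⟩)
    rw [Matrix.sub_mulVec, Matrix.smul_mulVec, Matrix.one_mulVec, sub_eq_zero] at hv
    rw [Matrix.toLin'_apply, hv]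
  have hinf : ∀ u : Fin m → ℂ, herForm (gram E + Z) (Sum.elim 0 u) =
      (star u ⬝ᵥ ((Eᴴ * E + (Z : Matrix _ _ ℂ)).toBlocks₂₂ *ᵥ u)).re := by
    intro u
    rw [coe_gram_add, herForm]
    simp [dotProduct, Matrix.mulVec, Matrix.toBlocks₂₂]
  have hblock : (Eᴴ * E + (Z : Matrix _ _ ℂ)).toBlocks₂₂.IsHermitian := by
    rw [coe_gram_add]
    exact (gram E + Z).isHermitian.submatrix Sum.inr
  have hpsd : (Eᴴ * E + (Z : Matrix _ _ ℂ)).toBlocks₂₂.PosSemidef ↔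
      ∀ u : Fin m → ℂ, 0 ≤ herForm (gram E + Z) (Sum.elim 0 u) := by
    refine (posSemidef_iff_herForm ⟨_, hblock⟩).trans (forall_congr' fun u => ?_)
    rw [hinf]
    rfl
  rw [PopovFeasible, hpsd]
  simp only [DualFeasible, hN]
  constructor
  · intro h
    refine ⟨fun z hz => ?_, fun hz u => h _ ⟨_, hz, ?_⟩⟩
    · rw [coe_gram_add, popov_posSemidef_iff]
      refine fun u => h _ ⟨_, hz, ?_⟩
      rw [sys_mulVec, Matrix.fromRows_mulVec]
      simp only [Sum.elim_comp_inl, Sum.elim_comp_inr, one_smul, Matrix.one_mulVec]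
      rw [Matrix.mulVec_mulVec, ← Matrix.mul_assoc, Matrix.mul_nonsing_inv _ (hunit z hz),
        Matrix.one_mul, sub_self]
    · rw [sys_mulVec]
      simp
  · rintro ⟨h1, h2⟩ a ⟨⟨μ, ν⟩, hx, ha⟩
    rw [sys_mulVec] at ha
    by_cases hν : ν = 0
    · subst hν
      have hμ : μ ≠ 0 := fun hμ => hx.1 (by rw [hμ]; rfl)
      have h3 : ((1 : ℂ), (0 : ℂ)) ∈ curve Φ Ψ := by
        simpa [hμ] using curve_smul (inv_ne_zero hμ) hx
      have h4 : a ∘ Sum.inl = 0 := by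
        simpa [Matrix.smul_mulVec, hμ] using ha
      have h5 := h2 h3 (a ∘ Sum.inr)
      rwa [← h4, Sum.elim_comp_inl_inr] at h5
    · have h3 : (ν⁻¹ * μ, (1 : ℂ)) ∈ curve Φ Ψ := by
        simpa [hν] using curve_smul (inv_ne_zero hν) hx
      have h4 : ((ν⁻¹ * μ) • 1 - A) *ᵥ (a ∘ Sum.inl) = B *ᵥ (a ∘ Sum.inr) := by
        have h5 : (ν⁻¹ * μ) • (1 : Matrix (Fin s) (Fin s) ℂ) - A = ν⁻¹ • (μ • 1 - ν • A) := by
          rw [smul_sub, smul_smul, smul_smul, inv_mul_cancel₀ hν, one_smul]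
        rw [h5, Matrix.smul_mulVec, sub_eq_zero.1 ha, smul_smul, inv_mul_cancel₀ hν, one_smul]
      have h5 : Matrix.fromRows (((ν⁻¹ * μ) • 1 - A)⁻¹ * B) 1 *ᵥ (a ∘ Sum.inr) = a := by
        rw [Matrix.fromRows_mulVec, ← Matrix.mulVec_mulVec, ← h4, Matrix.mulVec_mulVec,
          Matrix.nonsing_inv_mul _ (hunit _ h3), Matrix.one_mulVec, Matrix.one_mulVec,
          Sum.elim_comp_inl_inr]
      have h6 := h1 _ h3
      rw [coe_gram_add, popov_posSemidef_iff] at h6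
      rw [← h5]
      exact h6 _

end system

end

end SymGauge

theorem mainTheorem4
    (Φ Ψ : SymGauge.Herm (Fin 2))
    (hΦ : (Φ : Matrix (Fin 2) (Fin 2) ℂ).det.re < 0)
    (hC : SymGauge.IsOneDimensional Φ Ψ) :
    -- general pencils
    (∀ (p n q : Type) [Fintype p] [Fintype n] [Fintype q]
      (F G : Matrix p n ℂ) (E : Matrix q n ℂ), SymGauge.FullRowRank F G →
      -- the gauge, in semidefinite form
      (∀ X : SymGauge.Herm n,
        (SymGauge.PrimalFeasible Φ Ψ F G X →
          SymGauge.symGauge Φ Ψ F G E X = (((E * (X : Matrix n n ℂ) * Eᴴ).trace.re : ℝ) : EReal)) ∧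
        (¬ SymGauge.PrimalFeasible Φ Ψ F G X → SymGauge.symGauge Φ Ψ F G E X = ⊤)) ∧
      -- the conjugate of the gauge
      (∀ Z : SymGauge.Herm n,
        (SymGauge.conjugate (SymGauge.symGauge Φ Ψ F G E) Z = 0 ↔
          SymGauge.LMIFeasible Φ Ψ F G E Z) ∧
        (SymGauge.LMIFeasible Φ Ψ F G E Z ↔ SymGauge.BoundedOnDict Φ Ψ F G E Z) ∧
        (¬ SymGauge.BoundedOnDict Φ Ψ F G E Z →
          SymGauge.conjugate (SymGauge.symGauge Φ Ψ F G E) Z = ⊤) ∧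
        -- the case of a redundant inequality: the term with `Ψ` can be omitted
        ((∀ μ ν : ℂ, SymGauge.quadForm Φ μ ν = 0 → SymGauge.quadForm Ψ μ ν ≤ 0) →
          (SymGauge.LMIFeasible Φ Ψ F G E Z ↔ SymGauge.LMIFeasible Φ 0 F G E Z))) ∧
      -- the dual problem and complementary slackness
      (∀ f : SymGauge.Herm n → ℝ,
        SymGauge.primalValue Φ Ψ F G E f =
          (⨅ X : SymGauge.Herm n, ((f X : EReal) + SymGauge.symGauge Φ Ψ F G E X)) ∧
        SymGauge.dualValue Φ Ψ F G E f =
          (⨆ (Z : SymGauge.Herm n) (P : SymGauge.Herm p) (Q : SymGauge.Herm p)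
            (_ : SymGauge.IsCertificate Φ Ψ F G E (-Z) P Q), SymGauge.dualObj f Z) ∧
        SymGauge.dualValue Φ Ψ F G E f =
          (⨆ (Z : SymGauge.Herm n) (_ : SymGauge.DualFeasible Φ Ψ F G E Z),
            SymGauge.dualObj f Z) ∧
        SymGauge.dualValue Φ Ψ F G E f ≤ SymGauge.primalValue Φ Ψ F G E f ∧
        (SymGauge.primalValue Φ Ψ F G E f = SymGauge.dualValue Φ Ψ F G E f →
          ∀ (r : ℕ) (a : Fin r → n → ℂ) (Z : SymGauge.Herm n),
            (∀ k, a k ∈ SymGauge.dict Φ Ψ F G) →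
            (SymGauge.primalObj E f a : EReal) = SymGauge.primalValue Φ Ψ F G E f →
            SymGauge.DualFeasible Φ Ψ F G E Z →
            SymGauge.dualObj f Z = SymGauge.dualValue Φ Ψ F G E f →
            (f (∑ k, SymGauge.dyad (a k)) : EReal) +
                SymGauge.conjugate (fun X => (f X : EReal)) Z =
              ((SymGauge.trInner (∑ k, SymGauge.dyad (a k)) Z : ℝ) : EReal) ∧
            ∀ k, SymGauge.normSqE E (a k) + SymGauge.herForm Z (a k) = 0))) ∧
    -- controllability pencils: the generalized Kalman-Yakubovich-Popov lemma
    (∀ (s m : ℕ) (q : Type) [Fintype q]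
      (A : Matrix (Fin s) (Fin s) ℂ) (B : Matrix (Fin s) (Fin m) ℂ)
      (E : Matrix q (Fin s ⊕ Fin m) ℂ),
      SymGauge.Controllable A B →
      (∀ z : ℂ, (z, 1) ∈ SymGauge.curve Φ Ψ →
        ¬ Module.End.HasEigenvalue (Matrix.toLin' A) z) →
      SymGauge.FullRowRank (SymGauge.sysF A B) (SymGauge.sysG s m) ∧
      (∀ Z : SymGauge.Herm (Fin s ⊕ Fin m),
        (SymGauge.LMIFeasible Φ Ψ (SymGauge.sysF A B) (SymGauge.sysG s m) E (-Z) ↔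
          SymGauge.DualFeasible Φ Ψ (SymGauge.sysF A B) (SymGauge.sysG s m) E Z) ∧
        (SymGauge.DualFeasible Φ Ψ (SymGauge.sysF A B) (SymGauge.sysG s m) E Z ↔
          SymGauge.PopovFeasible Φ Ψ A B E Z)) ∧
      (∀ f : SymGauge.Herm (Fin s ⊕ Fin m) → ℝ,
        SymGauge.dualValue Φ Ψ (SymGauge.sysF A B) (SymGauge.sysG s m) E f =
          ⨆ (Z : SymGauge.Herm (Fin s ⊕ Fin m)) (_ : SymGauge.PopovFeasible Φ Ψ A B E Z),
            SymGauge.dualObj f Z)) := by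
  refine ⟨?_, ?_⟩
  · intro p n q _ _ _ F G E h
    refine ⟨fun X => ⟨fun hX => ?_, SymGauge.symGauge_eq_top E⟩, fun Z => ?_, fun f => ?_⟩
    · rw [SymGauge.trace_conj_re, SymGauge.symGauge_eq hΦ hC E hX]
    · have hZ := SymGauge.lmiFeasible_iff_boundedOnDict hΦ hC h E Z
      refine ⟨?_, hZ, SymGauge.conjugate_eq_top hΦ hC, fun hred => ?_⟩
      · rw [hZ]
        refine ⟨fun h0 => ?_, SymGauge.BoundedOnDict.conjugate_eq_zero hΦ hC⟩
        by_contra hb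
        rw [SymGauge.conjugate_eq_top hΦ hC hb] at h0
        exact EReal.top_ne_zero h0
      -- Both inequalities are equivalent to boundedness on `𝒜`, which depends on `Ψ` only through
      -- `𝒞`.
      · have hcurve := SymGauge.curve_eq_of_redundant hred
        rw [hZ, SymGauge.lmiFeasible_iff_boundedOnDict hΦ
          (by rwa [SymGauge.IsOneDimensional, ← hcurve]) h, SymGauge.BoundedOnDict,
          SymGauge.BoundedOnDict, SymGauge.dict, SymGauge.dict, hcurve]
    · have hdual := SymGauge.dualValue_eq hΦ hC F G E f
      refine ⟨SymGauge.primalValue_eq hΦ hC F G E f, ?_, hdual, ?_, ?_⟩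
      · rw [hdual]
        refine iSup_congr fun Z => ?_
        have hZ := (SymGauge.dualFeasible_iff Φ Ψ F G E Z).trans
          (SymGauge.lmiFeasible_iff_boundedOnDict hΦ hC h E (-Z)).symm
        rw [iSup_congr_Prop hZ fun _ => rfl]
        simp only [SymGauge.LMIFeasible, iSup_exists]
      · rw [hdual]
        exact iSup₂_le fun Z hZ => le_iInf fun r => le_iInf₂ fun a ha =>
          hZ.dualObj_le_primalObj f ha
      · intro heq r a Z ha hopt hZ hZopt
        exact SymGauge.complementary_slackness hZ ha (by rw [hopt, heq, hZopt])
  · intro s m q _ A B E hAB hA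
    have hpopov := fun Z => SymGauge.dualFeasible_iff_popovFeasible B E Z hA
    refine ⟨hAB.fullRowRank, fun Z => ⟨?_, hpopov Z⟩, fun f => ?_⟩
    · rw [SymGauge.dualFeasible_iff]
      exact SymGauge.lmiFeasible_iff_boundedOnDict hΦ hC hAB.fullRowRank E (-Z)
    · rw [SymGauge.dualValue_eq hΦ hC]
      exact iSup_congr fun Z => iSup_congr_Prop (hpopov Z) fun _ => rfl
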